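/- Let $R$ be a commutative ring with unity; $\otimes$ means $\otimes_R$. Let $C$ and $D$ be (coassociative, counital) $R$-coalgebras that are flat as $R$-modules. For a right $C$-comodule $(M,\varrho_M)$ and a left $C$-comodule $(N,\varrho_N)$ let $$M\,\square_C N=\ker\bigl(\varrho_M\otimes \mathrm{id}-\mathrm{id}\otimes\varrho_N : M\otimes N\to M\otimes C\otimes N\bigr).$$ If $M$ is a $D$-$C$-bicomodule (resp. $N$ is a $C$-$D$-bicomodule), $M\,\square_C N$ is a left (resp. right) $D$-subcomodule of $M\otimes N$. A submodule $W\subseteq V$ is pure if $W\otimes X\to V\otimes X$ is injective for every $R$-module $X$. $C$ and $D$ are called Morita–Takeuchi equivalent if the categories of right comodules $\mathcal M^C$ and $\mathcal M^D$ are equivalent as $R$-linear categories (i.e. by an additive $R$-linear equivalence). A Morita–Takeuchi context $(D,C,M,N,f,g)$ consists of a $D$-$C$-bicomodule $M$, a $C$-$D$-bicomodule $N$ and bicomodule morphisms $f:D\to M\,\square_C N$, $g:C\to N\,\square_D M$ such that 1. $M$ and $N$ are flat as $R$-modules; 2. $M\,\square_C N$ is pure in $M\otimes N$ and $N\,\square_D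 M$ is pure in $N\otimes M$; 3. under the canonical identifications $M\cong M\,\square_C C\cong D\,\square_D M$, $N\cong N\,\square_D D\cong C\,\square_C N$, $(M\,\square_C N)\,\square_D M\cong M\,\square_C (N\,\square_D M)$ and $(N\,\square_D M)\,\square_C N\cong N\,\square_D (M\,\square_C N)$, $$\mathrm{id}_M\,\square_C\, g=f\,\square_D\,\mathrm{id}_M \ \text{ on } M,\qquad \mathrm{id}_N\,\square_D\, f=g\,\square_C\,\mathrm{id}_N \ \text{ on } N.$$ It is called strict if $f$ and $g$ are bijective. **Theorem.** $C$ and $D$ are Morita–Takeuchi equivalent if and only if there exists a strict Morita–Takeuchi context $(D,C,M,N,f,g)$. -/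

import Mathlib

open scoped TensorProduct
open CategoryTheory

universe u v w x y z

namespace MoritaTakeuchi

set_option linter.unusedSectionVars false

/-! ### Comodules and bicomodules over a coalgebra -/

section Comodules

variable (R : Type u) [CommRing R] (C : Type v) [AddCommGroup C] [Module R C] [Coalgebra R C]

/-- A right `C`-comodule structure on the `R`-module `M`. -/
class RightComodule (M : Type w) [AddCommGroup M] [Module R M] where
  /-- the coaction `M → M ⊗ C` -/
  coact : M →ₗ[R] M ⊗[R] C
  coassoc : (TensorProduct.assoc R M C C).toLinearMap ∘ₗ coact.rTensor C ∘ₗ coact =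
    (Coalgebra.comul (R := R) (A := C)).lTensor M ∘ₗ coact
  counit_coact : (TensorProduct.rid R M).toLinearMap ∘ₗ
    (Coalgebra.counit (R := R) (A := C)).lTensor M ∘ₗ coact = LinearMap.id

/-- A left `C`-comodule structure on the `R`-module `M`. -/
class LeftComodule (M : Type w) [AddCommGroup M] [Module R M] where
  /-- the coaction `M → C ⊗ M` -/
  coact : M →ₗ[R] C ⊗[R] M
  coassoc : (TensorProduct.assoc R C C M).toLinearMap ∘ₗ
      (Coalgebra.comul (R := R) (A := C)).rTensor M ∘ₗ coact =
    coact.lTensor C ∘ₗ coact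
  counit_coact : (TensorProduct.lid R M).toLinearMap ∘ₗ
    (Coalgebra.counit (R := R) (A := C)).rTensor M ∘ₗ coact = LinearMap.id

/-- The right coaction `M → M ⊗ C`. -/
abbrev rcoact (M : Type w) [AddCommGroup M] [Module R M] [RightComodule R C M] :
    M →ₗ[R] M ⊗[R] C := RightComodule.coact

/-- The left coaction `M → C ⊗ M`. -/
abbrev lcoact (M : Type w) [AddCommGroup M] [Module R M] [LeftComodule R C M] :
    M →ₗ[R] C ⊗[R] M := LeftComodule.coact

/-- A left `C`-comodule and right `D`-comodule `M` is a `C`-`D`-bicomodule if its two coactions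
commute. -/
class IsBicomodule (D : Type x) [AddCommGroup D] [Module R D] [Coalgebra R D]
    (M : Type w) [AddCommGroup M] [Module R M] [LeftComodule R C M] [RightComodule R D M] :
    Prop where
  comm : (TensorProduct.assoc R C M D).toLinearMap ∘ₗ (lcoact R C M).rTensor D ∘ₗ rcoact R D M =
    (rcoact R D M).lTensor C ∘ₗ lcoact R C M

variable {M : Type w} [AddCommGroup M] [Module R M] {N : Type x} [AddCommGroup N] [Module R N]

/-- `C`-colinear maps of right `C`-comodules. -/
def IsRightColinear [RightComodule R C M] [RightComodule R C N] (f : M →ₗ[R] N) : Prop :=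
  rcoact R C N ∘ₗ f = f.rTensor C ∘ₗ rcoact R C M

/-- `C`-colinear maps of left `C`-comodules. -/
def IsLeftColinear [LeftComodule R C M] [LeftComodule R C N] (f : M →ₗ[R] N) : Prop :=
  lcoact R C N ∘ₗ f = f.lTensor C ∘ₗ lcoact R C M

/-- The coalgebra `C` as a right comodule over itself. -/
instance : RightComodule R C C where
  coact := Coalgebra.comul
  coassoc := Coalgebra.coassoc
  counit_coact := by
    rw [Coalgebra.lTensor_counit_comp_comul]; ext; simp

/-- The coalgebra `C` as a left comodule over itself. -/
instance : LeftComodule R C C where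
  coact := Coalgebra.comul
  coassoc := Coalgebra.coassoc
  counit_coact := by
    rw [Coalgebra.rTensor_counit_comp_comul]; ext; simp

instance : IsBicomodule R C C C where
  comm := Coalgebra.coassoc

end Comodules

/-! ### The category of right comodules -/

section Category

variable (R : Type u) [CommRing R] (C : Type u) [AddCommGroup C] [Module R C] [Coalgebra R C]

/-- The `R`-module `Com_C(M, N)` of colinear maps between right `C`-comodules. -/
def comHom (M N : Type u) [AddCommGroup M] [Module R M] [RightComodule R C M]
    [AddCommGroup N] [Module R N] [RightComodule R C N] : Submodule R (M →ₗ[R] N) where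
  carrier := {f | IsRightColinear R C f}
  add_mem' {f g} hf hg := by
    simp only [IsRightColinear, Set.mem_ofPred_eq] at *
    rw [LinearMap.comp_add, hf, hg, LinearMap.rTensor_add, LinearMap.add_comp]
  zero_mem' := by simp [IsRightColinear]
  smul_mem' r f hf := by
    simp only [IsRightColinear, Set.mem_ofPred_eq] at *
    rw [LinearMap.comp_smul, hf, LinearMap.rTensor_smul, LinearMap.smul_comp]

/-- Objects of the category `𝓜^C` of right `C`-comodules. -/
structure RightComodCat where
  carrier : Type u
  [addCommGroup : AddCommGroup carrier]
  [module : Module R carrier]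
  [comodule : RightComodule R C carrier]

attribute [instance] RightComodCat.addCommGroup RightComodCat.module RightComodCat.comodule

/-- The category `𝓜^C` of right `C`-comodules and colinear maps. -/
instance : Category (RightComodCat R C) where
  Hom X Y := comHom R C X.carrier Y.carrier
  id X := ⟨LinearMap.id, by
    change _ = _
    rw [LinearMap.rTensor_id]; rfl⟩
  comp f g := ⟨g.1 ∘ₗ f.1, by
    have hf : _ = _ := f.2
    have hg : _ = _ := g.2
    change _ = _
    rw [LinearMap.rTensor_comp, ← LinearMap.comp_assoc, hg, LinearMap.comp_assoc, hf,
      LinearMap.comp_assoc]⟩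

instance : Preadditive (RightComodCat R C) where
  homGroup X Y := inferInstanceAs (AddCommGroup (comHom R C X.carrier Y.carrier))
  add_comp _ _ _ f f' g := Subtype.ext (LinearMap.comp_add f.1 f'.1 g.1)
  comp_add _ _ _ f g g' := Subtype.ext (LinearMap.add_comp f.1 g'.1 g.1)

instance : Linear R (RightComodCat R C) where
  homModule X Y := inferInstanceAs (Module R (comHom R C X.carrier Y.carrier))
  smul_comp _ _ _ r f g := Subtype.ext (LinearMap.comp_smul g.1 r f.1)
  comp_smul _ _ _ f r g := Subtype.ext (LinearMap.smul_comp r g.1 f.1)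

/-- Two coalgebras over `R` are Morita–Takeuchi equivalent if their categories of right comodules
are equivalent. As usual for `R`-linear categories, functors are additive and `R`-linear. -/
def MoritaTakeuchiEquivalent (D : Type u) [AddCommGroup D] [Module R D] [Coalgebra R D] : Prop :=
  ∃ e : RightComodCat R C ≌ RightComodCat R D, e.functor.Additive ∧ e.functor.Linear R

end Category

/-! ### The cotensor product -/

section Cotensor

variable (R : Type u) [CommRing R] (C : Type v) [AddCommGroup C] [Module R C] [Coalgebra R C]
  (M : Type w) [AddCommGroup M] [Module R M] [RightComodule R C M]
  (N : Type x) [AddCommGroup N] [Module R N] [LeftComodule R C N]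

/-- The map `ρ_M ⊗ id - id ⊗ ρ_N : M ⊗ N → M ⊗ C ⊗ N`. -/
def cotensorMap : M ⊗[R] N →ₗ[R] M ⊗[R] (C ⊗[R] N) :=
  (TensorProduct.assoc R M C N).toLinearMap ∘ₗ (rcoact R C M).rTensor N -
    (lcoact R C N).lTensor M

/-- The cotensor product `M □_C N`, as a submodule of `M ⊗ N`. -/
def Cotensor : Submodule R (M ⊗[R] N) := LinearMap.ker (cotensorMap R C M N)

end Cotensor

/-- A submodule `W` of an `R`-module `V` is pure if `W ⊗ X → V ⊗ X` is injective for every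
`R`-module `X`. -/
def IsPure {R : Type u} [CommRing R] {V : Type u} [AddCommGroup V] [Module R V]
    (W : Submodule R V) : Prop :=
  ∀ (X : Type u) [AddCommGroup X] [Module R X], Function.Injective (W.subtype.rTensor X)

/-! ### The comodule structures on a tensor product and on a cotensor product -/

section Flat

variable {R : Type u} [CommRing R] (D : Type v) [AddCommGroup D] [Module R D]
  [Module.Flat R D] {V : Type w} [AddCommGroup V] [Module R V]

theorem lTensor_subtype_injective (W : Submodule R V) :
    Function.Injective (W.subtype.lTensor D) :=
  Module.Flat.lTensor_preserves_injective_linearMap _ W.injective_subtype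

theorem rTensor_subtype_injective (W : Submodule R V) :
    Function.Injective (W.subtype.rTensor D) :=
  Module.Flat.rTensor_preserves_injective_linearMap _ W.injective_subtype

end Flat

section Transfer

variable {R : Type u} [CommRing R] {D : Type v} [AddCommGroup D] [Module R D] [Coalgebra R D]
  {V : Type w} [AddCommGroup V] [Module R V] {W : Type x} [AddCommGroup W] [Module R W]

theorem lcoassoc_nat (j : W →ₗ[R] V) (r : W →ₗ[R] D ⊗[R] W) (s : V →ₗ[R] D ⊗[R] V)
    (h : s ∘ₗ j = j.lTensor D ∘ₗ r) :
    ((TensorProduct.assoc R D D V).toLinearMap ∘ₗ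
        (Coalgebra.comul (R := R) (A := D)).rTensor V ∘ₗ s) ∘ₗ j =
      (j.lTensor D).lTensor D ∘ₗ (TensorProduct.assoc R D D W).toLinearMap ∘ₗ
        (Coalgebra.comul (R := R) (A := D)).rTensor W ∘ₗ r := by
  have e : (TensorProduct.assoc R D D V).toLinearMap ∘ₗ j.lTensor (D ⊗[R] D) =
      (j.lTensor D).lTensor D ∘ₗ (TensorProduct.assoc R D D W).toLinearMap := by
    ext; simp
  rw [LinearMap.comp_assoc, LinearMap.comp_assoc, h, ← LinearMap.comp_assoc r,
    LinearMap.rTensor_comp_lTensor, ← LinearMap.lTensor_comp_rTensor, LinearMap.comp_assoc,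
    ← LinearMap.comp_assoc, e, LinearMap.comp_assoc]

theorem lcoassoc_nat' (j : W →ₗ[R] V) (r : W →ₗ[R] D ⊗[R] W) (s : V →ₗ[R] D ⊗[R] V)
    (h : s ∘ₗ j = j.lTensor D ∘ₗ r) :
    (s.lTensor D ∘ₗ s) ∘ₗ j = (j.lTensor D).lTensor D ∘ₗ r.lTensor D ∘ₗ r := by
  rw [LinearMap.comp_assoc, h, ← LinearMap.comp_assoc, ← LinearMap.lTensor_comp, h,
    LinearMap.lTensor_comp, LinearMap.comp_assoc]

theorem lcounit_nat (j : W →ₗ[R] V) (r : W →ₗ[R] D ⊗[R] W) (s : V →ₗ[R] D ⊗[R] V)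
    (h : s ∘ₗ j = j.lTensor D ∘ₗ r) :
    ((TensorProduct.lid R V).toLinearMap ∘ₗ
        (Coalgebra.counit (R := R) (A := D)).rTensor V ∘ₗ s) ∘ₗ j =
      j ∘ₗ (TensorProduct.lid R W).toLinearMap ∘ₗ
        (Coalgebra.counit (R := R) (A := D)).rTensor W ∘ₗ r := by
  have e : (TensorProduct.lid R V).toLinearMap ∘ₗ j.lTensor R =
      j ∘ₗ (TensorProduct.lid R W).toLinearMap := by
    ext; simp
  rw [LinearMap.comp_assoc, LinearMap.comp_assoc, h, ← LinearMap.comp_assoc r,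
    LinearMap.rTensor_comp_lTensor, ← LinearMap.lTensor_comp_rTensor, LinearMap.comp_assoc,
    ← LinearMap.comp_assoc, e, LinearMap.comp_assoc]

theorem rcoassoc_nat (j : W →ₗ[R] V) (r : W →ₗ[R] W ⊗[R] D) (s : V →ₗ[R] V ⊗[R] D)
    (h : s ∘ₗ j = j.rTensor D ∘ₗ r) :
    ((TensorProduct.assoc R V D D).toLinearMap ∘ₗ s.rTensor D ∘ₗ s) ∘ₗ j =
      j.rTensor (D ⊗[R] D) ∘ₗ (TensorProduct.assoc R W D D).toLinearMap ∘ₗ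
        r.rTensor D ∘ₗ r := by
  have e : (TensorProduct.assoc R V D D).toLinearMap ∘ₗ (j.rTensor D).rTensor D =
      j.rTensor (D ⊗[R] D) ∘ₗ (TensorProduct.assoc R W D D).toLinearMap := by
    ext; simp
  rw [LinearMap.comp_assoc, LinearMap.comp_assoc, h, ← LinearMap.comp_assoc r,
    ← LinearMap.rTensor_comp, h, LinearMap.rTensor_comp, LinearMap.comp_assoc,
    ← LinearMap.comp_assoc, e, LinearMap.comp_assoc]

theorem rcoassoc_nat' (j : W →ₗ[R] V) (r : W →ₗ[R] W ⊗[R] D) (s : V →ₗ[R] V ⊗[R] D)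
    (h : s ∘ₗ j = j.rTensor D ∘ₗ r) :
    ((Coalgebra.comul (R := R) (A := D)).lTensor V ∘ₗ s) ∘ₗ j =
      j.rTensor (D ⊗[R] D) ∘ₗ (Coalgebra.comul (R := R) (A := D)).lTensor W ∘ₗ r := by
  rw [LinearMap.comp_assoc, h, ← LinearMap.comp_assoc, LinearMap.lTensor_comp_rTensor,
    ← LinearMap.rTensor_comp_lTensor, LinearMap.comp_assoc]

theorem rcounit_nat (j : W →ₗ[R] V) (r : W →ₗ[R] W ⊗[R] D) (s : V →ₗ[R] V ⊗[R] D)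
    (h : s ∘ₗ j = j.rTensor D ∘ₗ r) :
    ((TensorProduct.rid R V).toLinearMap ∘ₗ
        (Coalgebra.counit (R := R) (A := D)).lTensor V ∘ₗ s) ∘ₗ j =
      j ∘ₗ (TensorProduct.rid R W).toLinearMap ∘ₗ
        (Coalgebra.counit (R := R) (A := D)).lTensor W ∘ₗ r := by
  have e : (TensorProduct.rid R V).toLinearMap ∘ₗ j.rTensor R =
      j ∘ₗ (TensorProduct.rid R W).toLinearMap := by
    ext; simp
  rw [LinearMap.comp_assoc, LinearMap.comp_assoc, h, ← LinearMap.comp_assoc r,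
    LinearMap.lTensor_comp_rTensor, ← LinearMap.rTensor_comp_lTensor, LinearMap.comp_assoc,
    ← LinearMap.comp_assoc, e, LinearMap.comp_assoc]

end Transfer

section Sub

variable (R : Type u) [CommRing R] (D : Type v) [AddCommGroup D] [Module R D] [Coalgebra R D]

theorem tensorLeft_aux (M : Type w) [AddCommGroup M] [Module R M] (r : M →ₗ[R] D ⊗[R] M)
    (N : Type x) [AddCommGroup N] [Module R N] (n : N) :
    ((TensorProduct.assoc R D M N).toLinearMap ∘ₗ r.rTensor N) ∘ₗ
      (TensorProduct.mk R M N).flip n = ((TensorProduct.mk R M N).flip n).lTensor D ∘ₗ r := by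
  have e : (TensorProduct.assoc R D M N).toLinearMap ∘ₗ
      (TensorProduct.mk R (D ⊗[R] M) N).flip n = ((TensorProduct.mk R M N).flip n).lTensor D := by
    ext; simp
  rw [← e]
  ext; simp

theorem tensorRight_aux (M : Type w) [AddCommGroup M] [Module R M]
    (N : Type x) [AddCommGroup N] [Module R N] (r : N →ₗ[R] N ⊗[R] D) (m : M) :
    ((TensorProduct.assoc R M N D).symm.toLinearMap ∘ₗ r.lTensor M) ∘ₗ
      TensorProduct.mk R M N m = (TensorProduct.mk R M N m).rTensor D ∘ₗ r := by
  have e : (TensorProduct.assoc R M N D).symm.toLinearMap ∘ₗ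
      TensorProduct.mk R M (N ⊗[R] D) m = (TensorProduct.mk R M N m).rTensor D := by
    ext; simp
  rw [← e]
  ext; simp

/-- `M ⊗ N` as a left comodule, through a left coaction on `M`. -/
instance tensorLeft (M : Type w) [AddCommGroup M] [Module R M] [LeftComodule R D M]
    (N : Type x) [AddCommGroup N] [Module R N] : LeftComodule R D (M ⊗[R] N) where
  coact := (TensorProduct.assoc R D M N).toLinearMap ∘ₗ (lcoact R D M).rTensor N
  coassoc := by
    refine TensorProduct.ext' fun m n => ?_
    have a := lcoassoc_nat _ _ _ (tensorLeft_aux R D M (lcoact R D M) N n)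
    have b := lcoassoc_nat' _ _ _ (tensorLeft_aux R D M (lcoact R D M) N n)
    rw [LeftComodule.coassoc, ← b] at a
    exact LinearMap.congr_fun a m
  counit_coact := by
    refine TensorProduct.ext' fun m n => ?_
    have a := lcounit_nat _ _ _ (tensorLeft_aux R D M (lcoact R D M) N n)
    rw [LeftComodule.counit_coact] at a
    exact LinearMap.congr_fun a m

/-- `M ⊗ N` as a right comodule, through a right coaction on `N`. -/
instance tensorRight (M : Type w) [AddCommGroup M] [Module R M]
    (N : Type x) [AddCommGroup N] [Module R N] [RightComodule R D N] :
    RightComodule R D (M ⊗[R] N) where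
  coact := (TensorProduct.assoc R M N D).symm.toLinearMap ∘ₗ (rcoact R D N).lTensor M
  coassoc := by
    refine TensorProduct.ext' fun m n => ?_
    have a := rcoassoc_nat _ _ _ (tensorRight_aux R D M N (rcoact R D N) m)
    have b := rcoassoc_nat' _ _ _ (tensorRight_aux R D M N (rcoact R D N) m)
    rw [RightComodule.coassoc, ← b] at a
    exact LinearMap.congr_fun a n
  counit_coact := by
    refine TensorProduct.ext' fun m n => ?_
    have a := rcounit_nat _ _ _ (tensorRight_aux R D M N (rcoact R D N) m)
    rw [RightComodule.counit_coact] at a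
    exact LinearMap.congr_fun a n

variable {R} [Module.Flat R D] {V : Type w} [AddCommGroup V] [Module R V]

/-- If `D` is flat and the coaction of `V` maps `W` into `D ⊗ W ⊆ D ⊗ V`, this is the
restricted coaction `W → D ⊗ W`. -/
noncomputable def subLeftCoact [LeftComodule R D V] (W : Submodule R V)
    (h : ∀ m : W, lcoact R D V m ∈ LinearMap.range (W.subtype.lTensor D)) : W →ₗ[R] D ⊗[R] W :=
  (LinearEquiv.ofInjective _ (lTensor_subtype_injective D W)).symm.toLinearMap ∘ₗ
    (lcoact R D V ∘ₗ W.subtype).codRestrict _ h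

theorem subLeftCoact_spec [LeftComodule R D V] (W : Submodule R V)
    (h : ∀ m : W, lcoact R D V m ∈ LinearMap.range (W.subtype.lTensor D)) :
    lcoact R D V ∘ₗ W.subtype = W.subtype.lTensor D ∘ₗ subLeftCoact D W h := by
  ext m
  exact (congrArg Subtype.val ((LinearEquiv.ofInjective _
    (lTensor_subtype_injective D W)).apply_symm_apply
      ((lcoact R D V ∘ₗ W.subtype).codRestrict _ h m))).symm

/-- If `D` is flat and the coaction of `V` maps `W` into `W ⊗ D ⊆ V ⊗ D`, this is the
restricted coaction `W → W ⊗ D`. -/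
noncomputable def subRightCoact [RightComodule R D V] (W : Submodule R V)
    (h : ∀ m : W, rcoact R D V m ∈ LinearMap.range (W.subtype.rTensor D)) : W →ₗ[R] W ⊗[R] D :=
  (LinearEquiv.ofInjective _ (rTensor_subtype_injective D W)).symm.toLinearMap ∘ₗ
    (rcoact R D V ∘ₗ W.subtype).codRestrict _ h

theorem subRightCoact_spec [RightComodule R D V] (W : Submodule R V)
    (h : ∀ m : W, rcoact R D V m ∈ LinearMap.range (W.subtype.rTensor D)) :
    rcoact R D V ∘ₗ W.subtype = W.subtype.rTensor D ∘ₗ subRightCoact D W h := by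
  ext m
  exact (congrArg Subtype.val ((LinearEquiv.ofInjective _
    (rTensor_subtype_injective D W)).apply_symm_apply
      ((rcoact R D V ∘ₗ W.subtype).codRestrict _ h m))).symm

/-- Subcomodules of a left comodule. -/
noncomputable abbrev subLeft [LeftComodule R D V] (W : Submodule R V)
    (h : ∀ m : W, lcoact R D V m ∈ LinearMap.range (W.subtype.lTensor D)) :
    LeftComodule R D W where
  coact := subLeftCoact D W h
  coassoc := by
    have a := lcoassoc_nat _ _ _ (subLeftCoact_spec D W h)
    have b := lcoassoc_nat' _ _ _ (subLeftCoact_spec D W h)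
    rw [LeftComodule.coassoc, b] at a
    refine LinearMap.ext fun m => ?_
    exact (Module.Flat.lTensor_preserves_injective_linearMap (M := D) _
      (lTensor_subtype_injective D W) (LinearMap.congr_fun a m)).symm
  counit_coact := by
    have a := lcounit_nat _ _ _ (subLeftCoact_spec D W h)
    rw [LeftComodule.counit_coact] at a
    exact LinearMap.ext fun m => (W.injective_subtype (LinearMap.congr_fun a m)).symm

/-- Subcomodules of a right comodule. -/
noncomputable abbrev subRight [RightComodule R D V] (W : Submodule R V)
    (h : ∀ m : W, rcoact R D V m ∈ LinearMap.range (W.subtype.rTensor D)) :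
    RightComodule R D W where
  coact := subRightCoact D W h
  coassoc := by
    have a := rcoassoc_nat _ _ _ (subRightCoact_spec D W h)
    have b := rcoassoc_nat' _ _ _ (subRightCoact_spec D W h)
    rw [RightComodule.coassoc, b] at a
    refine LinearMap.ext fun m => ?_
    exact (rTensor_subtype_injective (D ⊗[R] D) W (LinearMap.congr_fun a m)).symm
  counit_coact := by
    have a := rcounit_nat _ _ _ (subRightCoact_spec D W h)
    rw [RightComodule.counit_coact] at a
    exact LinearMap.ext fun m => (W.injective_subtype (LinearMap.congr_fun a m)).symm

end Sub

section CotensorComodule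

variable {R : Type u} [CommRing R] {C : Type v} [AddCommGroup C] [Module R C] [Coalgebra R C]
  {D : Type y} [AddCommGroup D] [Module R D] [Coalgebra R D]
  {M : Type w} [AddCommGroup M] [Module R M] [RightComodule R C M]
  {N : Type x} [AddCommGroup N] [Module R N] [LeftComodule R C N]

theorem cotensorMap_leftColinear [LeftComodule R D M] [IsBicomodule R D C M] :
    IsLeftColinear R D (cotensorMap R C M N) := by
  refine TensorProduct.ext' fun m n => ?_
  have A : ∀ z : D ⊗[R] M, ((TensorProduct.assoc R M C N).toLinearMap ∘ₗ
        (rcoact R C M).rTensor N).lTensor D (TensorProduct.assoc R D M N (z ⊗ₜ n)) =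
      ((TensorProduct.assoc R M C N).toLinearMap ∘ₗ
        (TensorProduct.mk R (M ⊗[R] C) N).flip n).lTensor D ((rcoact R C M).lTensor D z) := by
    intro z
    induction z with
    | zero => simp
    | add a b ha hb => simp only [TensorProduct.add_tmul, map_add, ha, hb]
    | tmul d m => simp
  have B : ∀ y : M ⊗[R] C, lcoact R D (M ⊗[R] (C ⊗[R] N))
        (TensorProduct.assoc R M C N (y ⊗ₜ n)) =
      ((TensorProduct.assoc R M C N).toLinearMap ∘ₗ
        (TensorProduct.mk R (M ⊗[R] C) N).flip n).lTensor D
        (TensorProduct.assoc R D M C ((lcoact R D M).rTensor C y)) := by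
    intro y
    induction y with
    | zero => simp
    | add a b ha hb => simp only [TensorProduct.add_tmul, map_add, ha, hb]
    | tmul m c =>
      change TensorProduct.assoc R D M (C ⊗[R] N) (lcoact R D M m ⊗ₜ (c ⊗ₜ n)) =
        LinearMap.lTensor D _ (TensorProduct.assoc R D M C (lcoact R D M m ⊗ₜ c))
      generalize lcoact R D M m = q
      induction q with
      | zero => simp
      | add a b ha hb => simp only [TensorProduct.add_tmul, map_add, ha, hb]
      | tmul d m => simp
  have E : ∀ z : D ⊗[R] M, ((lcoact R C N).lTensor M).lTensor D
      (TensorProduct.assoc R D M N (z ⊗ₜ n)) =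
      TensorProduct.assoc R D M (C ⊗[R] N) (z ⊗ₜ lcoact R C N n) := by
    intro z
    induction z with
    | zero => simp
    | add a b ha hb => simp only [TensorProduct.add_tmul, map_add, ha, hb]
    | tmul d m => simp
  have comm := LinearMap.congr_fun (IsBicomodule.comm (R := R) (C := D) (D := C) (M := M)) m
  simp only [LinearMap.comp_apply, LinearEquiv.coe_coe] at comm
  change lcoact R D (M ⊗[R] (C ⊗[R] N)) (TensorProduct.assoc R M C N (rcoact R C M m ⊗ₜ n) -
      m ⊗ₜ lcoact R C N n) = (cotensorMap R C M N).lTensor D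
        (TensorProduct.assoc R D M N (lcoact R D M m ⊗ₜ n))
  rw [map_sub, B, cotensorMap, LinearMap.lTensor_sub, LinearMap.sub_apply, A, E, comm]
  rfl

theorem cotensorMap_rightColinear [RightComodule R D N] [IsBicomodule R C D N] :
    IsRightColinear R D (cotensorMap R C M N) := by
  refine TensorProduct.ext' fun m n => ?_
  have A : ∀ z : N ⊗[R] D, ((lcoact R C N).lTensor M).rTensor D
        ((TensorProduct.assoc R M N D).symm (m ⊗ₜ z)) =
      (TensorProduct.mk R M (C ⊗[R] N) m).rTensor D ((lcoact R C N).rTensor D z) := by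
    intro z
    induction z with
    | zero => simp
    | add a b ha hb => simp only [TensorProduct.tmul_add, map_add, ha, hb]
    | tmul n d => simp
  have B : ∀ y : C ⊗[R] N, rcoact R D (M ⊗[R] (C ⊗[R] N)) (m ⊗ₜ y) =
      (TensorProduct.mk R M (C ⊗[R] N) m).rTensor D
        ((TensorProduct.assoc R C N D).symm ((rcoact R D N).lTensor C y)) := by
    intro y
    exact LinearMap.congr_fun (tensorRight_aux R D M (C ⊗[R] N) (rcoact R D (C ⊗[R] N)) m) y
  have E : ∀ q : M ⊗[R] C, rcoact R D (M ⊗[R] (C ⊗[R] N)) (TensorProduct.assoc R M C N (q ⊗ₜ n)) =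
      ((TensorProduct.assoc R M C N).toLinearMap ∘ₗ
        TensorProduct.mk R (M ⊗[R] C) N q).rTensor D (rcoact R D N n) := by
    intro q
    induction q with
    | zero => simp
    | add a b ha hb =>
      simp only [TensorProduct.add_tmul, map_add, ha, hb, LinearMap.comp_add,
        LinearMap.rTensor_add, LinearMap.add_apply]
    | tmul m c =>
      rw [TensorProduct.assoc_tmul]
      change (TensorProduct.assoc R M (C ⊗[R] N) D).symm (m ⊗ₜ
        ((TensorProduct.assoc R C N D).symm (c ⊗ₜ rcoact R D N n))) = _
      generalize rcoact R D N n = z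
      induction z with
      | zero => simp
      | add a b ha hb => simp only [TensorProduct.tmul_add, map_add, ha, hb]
      | tmul n d => simp
  have F : ∀ z : N ⊗[R] D, ((TensorProduct.assoc R M C N).toLinearMap ∘ₗ
        (rcoact R C M).rTensor N).rTensor D ((TensorProduct.assoc R M N D).symm (m ⊗ₜ z)) =
      ((TensorProduct.assoc R M C N).toLinearMap ∘ₗ
        TensorProduct.mk R (M ⊗[R] C) N (rcoact R C M m)).rTensor D z := by
    intro z
    induction z with
    | zero => simp
    | add a b ha hb => simp only [TensorProduct.tmul_add, map_add, ha, hb]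
    | tmul n d => simp
  have comm := LinearMap.congr_fun (IsBicomodule.comm (R := R) (C := C) (D := D) (M := N)) n
  simp only [LinearMap.comp_apply, LinearEquiv.coe_coe] at comm
  change rcoact R D (M ⊗[R] (C ⊗[R] N)) (TensorProduct.assoc R M C N (rcoact R C M m ⊗ₜ n) -
      m ⊗ₜ lcoact R C N n) = (cotensorMap R C M N).rTensor D
        ((TensorProduct.assoc R M N D).symm (m ⊗ₜ rcoact R D N n))
  rw [map_sub, B, cotensorMap, LinearMap.rTensor_sub, LinearMap.sub_apply, F, E, A, ← comm,
    LinearEquiv.symm_apply_apply]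

theorem exact_cotensor :
    Function.Exact (Cotensor R C M N).subtype (cotensorMap R C M N) :=
  LinearMap.exact_subtype_ker_map _

theorem cotensor_lcoact_mem [Module.Flat R D] [LeftComodule R D M] [IsBicomodule R D C M]
    (t : Cotensor R C M N) : lcoact R D (M ⊗[R] N) t ∈
      LinearMap.range ((Cotensor R C M N).subtype.lTensor D) := by
  refine (Module.Flat.lTensor_exact D exact_cotensor _).1 ?_
  have h := LinearMap.congr_fun (cotensorMap_leftColinear (R := R) (C := C) (D := D) (M := M)
    (N := N)) t
  have h0 : cotensorMap R C M N t = 0 := t.2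
  rw [LinearMap.comp_apply, h0, map_zero] at h
  exact h.symm

theorem cotensor_rcoact_mem [Module.Flat R D] [RightComodule R D N] [IsBicomodule R C D N]
    (t : Cotensor R C M N) : rcoact R D (M ⊗[R] N) t ∈
      LinearMap.range ((Cotensor R C M N).subtype.rTensor D) := by
  refine (Module.Flat.rTensor_exact D exact_cotensor _).1 ?_
  have h := LinearMap.congr_fun (cotensorMap_rightColinear (R := R) (C := C) (D := D) (M := M)
    (N := N)) t
  have h0 : cotensorMap R C M N t = 0 := t.2
  rw [LinearMap.comp_apply, h0, map_zero] at h
  exact h.symm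

/-- For a `D`-`C`-bicomodule `M`, the cotensor product `M □_C N` is a left `D`-subcomodule of
`M ⊗ N`. -/
noncomputable instance cotensorLeft [Module.Flat R D] [LeftComodule R D M]
    [IsBicomodule R D C M] : LeftComodule R D (Cotensor R C M N) :=
  subLeft D (Cotensor R C M N) cotensor_lcoact_mem

/-- For a `C`-`D`-bicomodule `N`, the cotensor product `M □_C N` is a right `D`-subcomodule of
`M ⊗ N`. -/
noncomputable instance cotensorRight [Module.Flat R D] [RightComodule R D N]
    [IsBicomodule R C D N] : RightComodule R D (Cotensor R C M N) :=
  subRight D (Cotensor R C M N) cotensor_rcoact_mem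

theorem cotensor_subtype_leftColinear [Module.Flat R D] [LeftComodule R D M]
    [IsBicomodule R D C M] : IsLeftColinear R D (Cotensor R C M N).subtype :=
  subLeftCoact_spec D (Cotensor R C M N) cotensor_lcoact_mem

theorem cotensor_subtype_rightColinear [Module.Flat R D] [RightComodule R D N]
    [IsBicomodule R C D N] : IsRightColinear R D (Cotensor R C M N).subtype :=
  subRightCoact_spec D (Cotensor R C M N) cotensor_rcoact_mem

/-- The cotensor product of two bicomodules is a bicomodule. -/
instance cotensorBicomodule {E : Type z} [AddCommGroup E] [Module R E] [Coalgebra R E]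
    [Module.Flat R D] [Module.Flat R E] [LeftComodule R D M] [IsBicomodule R D C M]
    [RightComodule R E N] [IsBicomodule R C E N] :
    IsBicomodule R D E (Cotensor R C M N) where
  comm := by
    have hV : (TensorProduct.assoc R D (M ⊗[R] N) E).toLinearMap ∘ₗ
        (lcoact R D (M ⊗[R] N)).rTensor E ∘ₗ rcoact R E (M ⊗[R] N) =
        (rcoact R E (M ⊗[R] N)).lTensor D ∘ₗ lcoact R D (M ⊗[R] N) := by
      refine TensorProduct.ext' fun m n => ?_
      change TensorProduct.assoc R D (M ⊗[R] N) E ((lcoact R D (M ⊗[R] N)).rTensor E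
          ((TensorProduct.assoc R M N E).symm (m ⊗ₜ rcoact R E N n))) =
        (rcoact R E (M ⊗[R] N)).lTensor D (TensorProduct.assoc R D M N (lcoact R D M m ⊗ₜ n))
      have P : ∀ q : N ⊗[R] E, TensorProduct.assoc R D (M ⊗[R] N) E
          ((lcoact R D (M ⊗[R] N)).rTensor E ((TensorProduct.assoc R M N E).symm (m ⊗ₜ q))) =
          (TensorProduct.assoc R M N E).symm.toLinearMap.lTensor D
            (TensorProduct.assoc R D M (N ⊗[R] E) (lcoact R D M m ⊗ₜ q)) := by
        intro q
        induction q with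
        | zero => simp
        | add a b ha hb => simp only [TensorProduct.tmul_add, map_add, ha, hb]
        | tmul n e =>
          change TensorProduct.assoc R D (M ⊗[R] N) E
            (TensorProduct.assoc R D M N (lcoact R D M m ⊗ₜ n) ⊗ₜ e) = _
          generalize lcoact R D M m = p
          induction p with
          | zero => simp
          | add a b ha hb => simp only [TensorProduct.add_tmul, map_add, ha, hb]
          | tmul d m => simp
      have Q : ∀ p : D ⊗[R] M, (rcoact R E (M ⊗[R] N)).lTensor D
          (TensorProduct.assoc R D M N (p ⊗ₜ n)) =
          (TensorProduct.assoc R M N E).symm.toLinearMap.lTensor D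
            (TensorProduct.assoc R D M (N ⊗[R] E) (p ⊗ₜ rcoact R E N n)) := by
        intro p
        induction p with
        | zero => simp
        | add a b ha hb => simp only [TensorProduct.add_tmul, map_add, ha, hb]
        | tmul d m => rfl
      rw [P, Q]
    have hl : _ = _ := cotensor_subtype_leftColinear (R := R) (C := C) (D := D) (M := M) (N := N)
    have hr : _ = _ := cotensor_subtype_rightColinear (R := R) (C := C) (D := E) (M := M) (N := N)
    have e : (TensorProduct.assoc R D (M ⊗[R] N) E).toLinearMap ∘ₗ
        ((Cotensor R C M N).subtype.lTensor D).rTensor E =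
        ((Cotensor R C M N).subtype.rTensor E).lTensor D ∘ₗ
          (TensorProduct.assoc R D (Cotensor R C M N) E).toLinearMap := by
      ext; simp
    refine LinearMap.ext fun t => Module.Flat.lTensor_preserves_injective_linearMap (M := D) _
      (rTensor_subtype_injective E (Cotensor R C M N)) ?_
    refine LinearMap.congr_fun (f := LinearMap.lTensor D _ ∘ₗ _) (g := LinearMap.lTensor D _ ∘ₗ _)
      ?_ t
    rw [← LinearMap.comp_assoc, ← e, LinearMap.comp_assoc, ← LinearMap.comp_assoc (rcoact R E _),
      ← LinearMap.rTensor_comp, ← hl, LinearMap.rTensor_comp, LinearMap.comp_assoc, ← hr,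
      ← LinearMap.comp_assoc (lcoact R D _), ← LinearMap.lTensor_comp, ← hr,
      LinearMap.lTensor_comp, LinearMap.comp_assoc, ← hl, ← LinearMap.comp_assoc,
      ← LinearMap.comp_assoc, LinearMap.comp_assoc _ _ (TensorProduct.assoc R D _ E).toLinearMap,
      hV, LinearMap.comp_assoc]

end CotensorComodule

section CotensorFunctor

variable {R : Type u} [CommRing R] {C : Type v} [AddCommGroup C] [Module R C] [Coalgebra R C]
  (M : Type w) [AddCommGroup M] [Module R M]
  (N : Type x) [AddCommGroup N] [Module R N]

theorem cotensorMap_lTensor [RightComodule R C M] [LeftComodule R C N] {N' : Type y}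
    [AddCommGroup N'] [Module R N'] [LeftComodule R C N']
    (g : N →ₗ[R] N') (hg : IsLeftColinear R C g) :
    cotensorMap R C M N' ∘ₗ g.lTensor M = (g.lTensor C).lTensor M ∘ₗ cotensorMap R C M N := by
  have e : (TensorProduct.assoc R M C N').toLinearMap ∘ₗ g.lTensor (M ⊗[R] C) =
      (g.lTensor C).lTensor M ∘ₗ (TensorProduct.assoc R M C N).toLinearMap := by
    ext; simp
  rw [cotensorMap, cotensorMap, LinearMap.sub_comp, LinearMap.comp_sub, LinearMap.comp_assoc,
    LinearMap.rTensor_comp_lTensor, ← LinearMap.lTensor_comp_rTensor, ← LinearMap.comp_assoc, e,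
    LinearMap.comp_assoc, ← LinearMap.lTensor_comp, hg, LinearMap.lTensor_comp]

theorem cotensorMap_rTensor [LeftComodule R C N] [RightComodule R C M] {M' : Type y}
    [AddCommGroup M'] [Module R M'] [RightComodule R C M']
    (f : M →ₗ[R] M') (hf : IsRightColinear R C f) :
    cotensorMap R C M' N ∘ₗ f.rTensor N = f.rTensor (C ⊗[R] N) ∘ₗ cotensorMap R C M N := by
  have e : (TensorProduct.assoc R M' C N).toLinearMap ∘ₗ (f.rTensor C).rTensor N =
      f.rTensor (C ⊗[R] N) ∘ₗ (TensorProduct.assoc R M C N).toLinearMap := by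
    ext; simp
  rw [cotensorMap, cotensorMap, LinearMap.sub_comp, LinearMap.comp_sub, LinearMap.comp_assoc,
    ← LinearMap.rTensor_comp, hf, LinearMap.rTensor_comp, ← LinearMap.comp_assoc, e,
    LinearMap.comp_assoc, LinearMap.lTensor_comp_rTensor, LinearMap.rTensor_comp_lTensor]

variable {N} in
/-- The map `id □ g : M □_C N → M □_C N'` induced by a left colinear map `g : N → N'`. -/
def Cotensor.mapRight [RightComodule R C M] [LeftComodule R C N] {N' : Type y}
    [AddCommGroup N'] [Module R N'] [LeftComodule R C N']
    (g : N →ₗ[R] N') (hg : IsLeftColinear R C g) :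
    Cotensor R C M N →ₗ[R] Cotensor R C M N' :=
  (g.lTensor M).restrict fun t ht => by
    have h := LinearMap.congr_fun (cotensorMap_lTensor M N g hg) t
    have h0 : cotensorMap R C M N t = 0 := ht
    rwa [LinearMap.comp_apply, LinearMap.comp_apply, h0, map_zero] at h

variable {M} in
/-- The map `f □ id : M □_C N → M' □_C N` induced by a right colinear map `f : M → M'`. -/
def Cotensor.mapLeft [RightComodule R C M] [LeftComodule R C N] {M' : Type y}
    [AddCommGroup M'] [Module R M'] [RightComodule R C M']
    (f : M →ₗ[R] M') (hf : IsRightColinear R C f) :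
    Cotensor R C M N →ₗ[R] Cotensor R C M' N :=
  (f.rTensor N).restrict fun t ht => by
    have h := LinearMap.congr_fun (cotensorMap_rTensor M N f hf) t
    have h0 : cotensorMap R C M N t = 0 := ht
    rwa [LinearMap.comp_apply, LinearMap.comp_apply, h0, map_zero] at h

variable (R C) in
/-- The canonical isomorphism `M ≅ M □_C C`, given by the coaction of `M`. -/
noncomputable def Cotensor.rightUnit [RightComodule R C M] : M ≃ₗ[R] Cotensor R C M C :=
  LinearEquiv.ofLinearMap
    ((rcoact R C M).codRestrict _ fun m => by
      have h := LinearMap.congr_fun (RightComodule.coassoc (R := R) (C := C) (M := M)) m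
      exact sub_eq_zero.2 h)
    ((TensorProduct.rid R M).toLinearMap ∘ₗ
      (Coalgebra.counit (R := R) (A := C)).lTensor M ∘ₗ (Cotensor R C M C).subtype)
    (LinearMap.ext fun t => Subtype.ext (by
      have h1 : (TensorProduct.assoc R M C C).toLinearMap ((rcoact R C M).rTensor C t) =
        (Coalgebra.comul (R := R) (A := C)).lTensor M t := sub_eq_zero.1 t.2
      have h2 : ((TensorProduct.rid R C).toLinearMap ∘ₗ (Coalgebra.counit (R := R) (A := C)).lTensor
          C).lTensor M ∘ₗ (Coalgebra.comul (R := R) (A := C)).lTensor M = LinearMap.id := by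
        rw [← LinearMap.lTensor_comp, LinearMap.comp_assoc]
        exact (congrArg (LinearMap.lTensor M) (RightComodule.counit_coact (C := C) (M := C))).trans
          (LinearMap.lTensor_id _ _)
      have h3 : ((TensorProduct.rid R C).toLinearMap ∘ₗ (Coalgebra.counit (R := R) (A := C)).lTensor
          C).lTensor M ∘ₗ (TensorProduct.assoc R M C C).toLinearMap ∘ₗ (rcoact R C M).rTensor C =
          rcoact R C M ∘ₗ (TensorProduct.rid R M).toLinearMap ∘ₗ
            (Coalgebra.counit (R := R) (A := C)).lTensor M := by
        refine TensorProduct.ext' fun m c => ?_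
        simp only [LinearMap.comp_apply, LinearMap.rTensor_tmul, LinearMap.lTensor_tmul,
          LinearEquiv.coe_coe, TensorProduct.rid_tmul, map_smul]
        generalize rcoact R C M m = q
        induction q with
        | zero => simp
        | add a b ha hb => simp only [TensorProduct.add_tmul, map_add, ha, hb, smul_add]
        | tmul m d => simp
      exact (LinearMap.congr_fun h3 t).symm.trans ((congrArg _ h1).trans
        (LinearMap.congr_fun h2 t))))
    (RightComodule.counit_coact)

variable (R C) in
/-- The canonical isomorphism `N ≅ C □_C N`, given by the coaction of `N`. -/
noncomputable def Cotensor.leftUnit [LeftComodule R C N] : N ≃ₗ[R] Cotensor R C C N :=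
  LinearEquiv.ofLinearMap
    ((lcoact R C N).codRestrict _ fun n => by
      have h := LinearMap.congr_fun (LeftComodule.coassoc (R := R) (C := C) (M := N)) n
      exact sub_eq_zero.2 h)
    ((TensorProduct.lid R N).toLinearMap ∘ₗ
      (Coalgebra.counit (R := R) (A := C)).rTensor N ∘ₗ (Cotensor R C C N).subtype)
    (LinearMap.ext fun t => Subtype.ext (by
      have h1 : (TensorProduct.assoc R C C N).toLinearMap
          ((Coalgebra.comul (R := R) (A := C)).rTensor N t) =
        (lcoact R C N).lTensor C t := sub_eq_zero.1 t.2
      have h2 : (TensorProduct.lid R (C ⊗[R] N)).toLinearMap ∘ₗ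
          (Coalgebra.counit (R := R) (A := C)).rTensor (C ⊗[R] N) ∘ₗ
          (TensorProduct.assoc R C C N).toLinearMap ∘ₗ
          (Coalgebra.comul (R := R) (A := C)).rTensor N = LinearMap.id :=
        LeftComodule.counit_coact (R := R) (C := C) (M := C ⊗[R] N)
      have h3 : (TensorProduct.lid R (C ⊗[R] N)).toLinearMap ∘ₗ
          (Coalgebra.counit (R := R) (A := C)).rTensor (C ⊗[R] N) ∘ₗ (lcoact R C N).lTensor C =
          lcoact R C N ∘ₗ (TensorProduct.lid R N).toLinearMap ∘ₗ
            (Coalgebra.counit (R := R) (A := C)).rTensor N := by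
        refine TensorProduct.ext' fun c n => ?_
        simp
      exact (LinearMap.congr_fun h3 t).symm.trans
        ((congrArg ((TensorProduct.lid R (C ⊗[R] N)).toLinearMap ∘ₗ
          (Coalgebra.counit (R := R) (A := C)).rTensor (C ⊗[R] N)) h1.symm).trans
          (LinearMap.congr_fun h2 t))))
    (LeftComodule.counit_coact)

end CotensorFunctor

/-! ### Associativity of the cotensor product -/

section Assoc

variable (R : Type u) [CommRing R] (C : Type v) [AddCommGroup C] [Module R C] [Coalgebra R C]
  (D : Type z) [AddCommGroup D] [Module R D] [Coalgebra R D]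
  [Module.Flat R C] [Module.Flat R D]
  (M : Type w) [AddCommGroup M] [Module R M] [RightComodule R C M]
  (N : Type x) [AddCommGroup N] [Module R N] [LeftComodule R C N] [RightComodule R D N]
  [IsBicomodule R C D N]
  (P : Type y) [AddCommGroup P] [Module R P] [LeftComodule R D P]

/-- The canonical map `(M □_C N) □_D P → M ⊗ N ⊗ P`. -/
noncomputable def Cotensor.inclLeft :
    Cotensor R D (Cotensor R C M N) P →ₗ[R] M ⊗[R] (N ⊗[R] P) :=
  (TensorProduct.assoc R M N P).toLinearMap ∘ₗ (Cotensor R C M N).subtype.rTensor P ∘ₗ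
    (Cotensor R D (Cotensor R C M N) P).subtype

/-- The canonical map `M □_C (N □_D P) → M ⊗ N ⊗ P`. -/
noncomputable def Cotensor.inclRight :
    Cotensor R C M (Cotensor R D N P) →ₗ[R] M ⊗[R] (N ⊗[R] P) :=
  (Cotensor R D N P).subtype.lTensor M ∘ₗ (Cotensor R C M (Cotensor R D N P)).subtype

theorem Cotensor.inclLeft_injective [Module.Flat R P] :
    Function.Injective (Cotensor.inclLeft R C D M N P) :=
  (TensorProduct.assoc R M N P).injective.comp
    ((rTensor_subtype_injective P _).comp (Submodule.injective_subtype _))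

theorem Cotensor.inclRight_injective [Module.Flat R M] :
    Function.Injective (Cotensor.inclRight R C D M N P) :=
  (lTensor_subtype_injective M _).comp (Submodule.injective_subtype _)

theorem Cotensor.range_inclRight [Module.Flat R M] :
    LinearMap.range (Cotensor.inclRight R C D M N P) =
      LinearMap.ker (cotensorMap R C M (N ⊗[R] P)) ⊓
        LinearMap.ker ((cotensorMap R D N P).lTensor M) := by
  have hnat := cotensorMap_lTensor (R := R) (C := C) M (Cotensor R D N P)
    (Cotensor R D N P).subtype cotensor_subtype_leftColinear
  ext t
  simp only [Submodule.mem_inf, LinearMap.mem_ker, LinearMap.mem_range]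
  constructor
  · rintro ⟨s, rfl⟩
    constructor
    · have h := LinearMap.congr_fun hnat s
      have h0 : cotensorMap R C M (Cotensor R D N P) s = 0 := s.2
      rw [LinearMap.comp_apply, LinearMap.comp_apply, h0, map_zero] at h
      exact h
    · exact (Module.Flat.lTensor_exact M exact_cotensor _).2 ⟨s, rfl⟩
  · rintro ⟨h1, h2⟩
    obtain ⟨s, rfl⟩ := (Module.Flat.lTensor_exact M exact_cotensor _).1 h2
    refine ⟨⟨s, ?_⟩, rfl⟩
    have h := LinearMap.congr_fun hnat s
    rw [LinearMap.comp_apply, h1] at h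
    exact Module.Flat.lTensor_preserves_injective_linearMap (M := M) _
      (lTensor_subtype_injective C (Cotensor R D N P)) (h.symm.trans (map_zero _).symm)

theorem Cotensor.range_inclLeft [Module.Flat R P] :
    LinearMap.range (Cotensor.inclLeft R C D M N P) =
      LinearMap.ker (cotensorMap R C M (N ⊗[R] P)) ⊓
        LinearMap.ker ((cotensorMap R D N P).lTensor M) := by
  have hnat := cotensorMap_rTensor (R := R) (C := D) (Cotensor R C M N) P
    (Cotensor R C M N).subtype cotensor_subtype_rightColinear
  have hA : cotensorMap R C M (N ⊗[R] P) ∘ₗ (TensorProduct.assoc R M N P).toLinearMap =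
      ((TensorProduct.assoc R C N P).toLinearMap.lTensor M ∘ₗ
        (TensorProduct.assoc R M (C ⊗[R] N) P).toLinearMap) ∘ₗ
        (cotensorMap R C M N).rTensor P := by
    refine TensorProduct.ext_threefold fun m n p => ?_
    change TensorProduct.assoc R M C (N ⊗[R] P) (rcoact R C M m ⊗ₜ (n ⊗ₜ p)) -
        m ⊗ₜ (TensorProduct.assoc R C N P (lcoact R C N n ⊗ₜ p)) =
      (TensorProduct.assoc R C N P).toLinearMap.lTensor M
        (TensorProduct.assoc R M (C ⊗[R] N) P
          ((TensorProduct.assoc R M C N (rcoact R C M m ⊗ₜ n) - m ⊗ₜ lcoact R C N n) ⊗ₜ p))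
    rw [TensorProduct.sub_tmul, map_sub, map_sub, TensorProduct.assoc_tmul, LinearMap.lTensor_tmul]
    congr 1
    generalize rcoact R C M m = q
    induction q with
    | zero => simp
    | add a b ha hb => simp only [TensorProduct.add_tmul, map_add, ha, hb]
    | tmul m c => simp
  have hB : (cotensorMap R D N P).lTensor M ∘ₗ (TensorProduct.assoc R M N P).toLinearMap =
      (TensorProduct.assoc R M N (D ⊗[R] P)).toLinearMap ∘ₗ cotensorMap R D (M ⊗[R] N) P := by
    refine TensorProduct.ext_threefold fun m n p => ?_
    change m ⊗ₜ (TensorProduct.assoc R N D P (rcoact R D N n ⊗ₜ p) - n ⊗ₜ lcoact R D P p) =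
      TensorProduct.assoc R M N (D ⊗[R] P)
        (TensorProduct.assoc R (M ⊗[R] N) D P
          ((TensorProduct.assoc R M N D).symm (m ⊗ₜ rcoact R D N n) ⊗ₜ p) -
          (m ⊗ₜ n) ⊗ₜ lcoact R D P p)
    rw [TensorProduct.tmul_sub, map_sub, TensorProduct.assoc_tmul]
    congr 1
    generalize rcoact R D N n = q
    induction q with
    | zero => simp
    | add a b ha hb => simp only [TensorProduct.tmul_add, TensorProduct.add_tmul, map_add, ha, hb]
    | tmul n d => simp
  ext t
  obtain ⟨t, rfl⟩ := (TensorProduct.assoc R M N P).surjective t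
  have hA := LinearMap.congr_fun hA t
  have hB := LinearMap.congr_fun hB t
  simp only [LinearMap.comp_apply, LinearEquiv.coe_coe] at hA hB
  have iA : Function.Injective ((TensorProduct.assoc R C N P).toLinearMap.lTensor M) :=
    ((TensorProduct.assoc R C N P).lTensor M).injective
  rw [Submodule.mem_inf, LinearMap.mem_ker, LinearMap.mem_ker, hA, hB,
    LinearEquiv.map_eq_zero_iff, map_eq_zero_iff _ iA, LinearEquiv.map_eq_zero_iff,
    LinearMap.mem_range]
  constructor
  · rintro ⟨s, hs⟩
    have hs := (TensorProduct.assoc R M N P).injective hs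
    subst hs
    constructor
    · exact (Module.Flat.rTensor_exact P exact_cotensor _).2 ⟨s, rfl⟩
    · have h := LinearMap.congr_fun hnat s
      have h0 : cotensorMap R D (Cotensor R C M N) P s = 0 := s.2
      rw [LinearMap.comp_apply, LinearMap.comp_apply, h0, map_zero] at h
      exact h
  · rintro ⟨h1, h2⟩
    obtain ⟨s, rfl⟩ := (Module.Flat.rTensor_exact P exact_cotensor _).1 h1
    refine ⟨⟨s, ?_⟩, rfl⟩
    have h := LinearMap.congr_fun hnat s
    rw [LinearMap.comp_apply, h2] at h
    exact rTensor_subtype_injective (D ⊗[R] P) (Cotensor R C M N)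
      (h.symm.trans (map_zero _).symm)

/-- The canonical isomorphism `(M □_C N) □_D P ≅ M □_C (N □_D P)` for flat `M` and `P`: the one
compatible with the canonical maps of both sides into `M ⊗ N ⊗ P`. -/
noncomputable def Cotensor.assoc [Module.Flat R M] [Module.Flat R P] :
    Cotensor R D (Cotensor R C M N) P ≃ₗ[R] Cotensor R C M (Cotensor R D N P) :=
  LinearEquiv.ofInjective _ (Cotensor.inclLeft_injective R C D M N P) ≪≫ₗ
    LinearEquiv.ofEq _ _ ((Cotensor.range_inclLeft R C D M N P).trans
      (Cotensor.range_inclRight R C D M N P).symm) ≪≫ₗ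
    (LinearEquiv.ofInjective _ (Cotensor.inclRight_injective R C D M N P)).symm

theorem Cotensor.inclRight_assoc [Module.Flat R M] [Module.Flat R P]
    (t : Cotensor R D (Cotensor R C M N) P) :
    Cotensor.inclRight R C D M N P (Cotensor.assoc R C D M N P t) =
      Cotensor.inclLeft R C D M N P t := by
  have h := (LinearEquiv.ofInjective _
    (Cotensor.inclRight_injective R C D M N P)).apply_symm_apply
      ((LinearEquiv.ofEq _ _ ((Cotensor.range_inclLeft R C D M N P).trans
        (Cotensor.range_inclRight R C D M N P).symm))
        (LinearEquiv.ofInjective _ (Cotensor.inclLeft_injective R C D M N P) t))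
  exact congrArg Subtype.val h

end Assoc

/-! ### Morita–Takeuchi contexts -/

section Context

variable (R : Type u) [CommRing R]
  (D : Type u) [AddCommGroup D] [Module R D] [Coalgebra R D] [Module.Flat R D]
  (C : Type u) [AddCommGroup C] [Module R C] [Coalgebra R C] [Module.Flat R C]

/-- A Morita–Takeuchi context `(D, C, M, N, f, g)` over the flat `R`-coalgebras `D` and `C`. -/
structure MoritaTakeuchiContext where
  /-- the `D`-`C`-bicomodule `M` -/
  M : Type u
  [addCommGroupM : AddCommGroup M]
  [moduleM : Module R M]
  [leftM : LeftComodule R D M]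
  [rightM : RightComodule R C M]
  [bicomoduleM : IsBicomodule R D C M]
  /-- the `C`-`D`-bicomodule `N` -/
  N : Type u
  [addCommGroupN : AddCommGroup N]
  [moduleN : Module R N]
  [leftN : LeftComodule R C N]
  [rightN : RightComodule R D N]
  [bicomoduleN : IsBicomodule R C D N]
  [flatM : Module.Flat R M]
  [flatN : Module.Flat R N]
  pureMN : IsPure (Cotensor R C M N)
  pureNM : IsPure (Cotensor R D N M)
  /-- the bicomodule morphism `f : D → M □_C N` -/
  f : D →ₗ[R] Cotensor R C M N
  f_left : IsLeftColinear R D f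
  f_right : IsRightColinear R D f
  /-- the bicomodule morphism `g : C → N □_D M` -/
  g : C →ₗ[R] Cotensor R D N M
  g_left : IsLeftColinear R C g
  g_right : IsRightColinear R C g
  /-- the square `M ≅ M □ C → M □ N □ M ← D □ M ≅ M` -/
  diagramM : ∀ m : M,
    Cotensor.mapRight M g g_left (Cotensor.rightUnit R C M m) =
      Cotensor.assoc R C D M N M (Cotensor.mapLeft M f f_right (Cotensor.leftUnit R D M m))
  /-- the square `N ≅ N □ D → N □ M □ N ← C □ N ≅ N` -/
  diagramN : ∀ n : N,
    Cotensor.mapRight N f f_left (Cotensor.rightUnit R D N n) =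
      Cotensor.assoc R D C N M N (Cotensor.mapLeft N g g_right (Cotensor.leftUnit R C N n))

variable {R D C} in
/-- A Morita–Takeuchi context is strict if `f` and `g` are bijective. -/
def MoritaTakeuchiContext.IsStrict (K : MoritaTakeuchiContext R D C) : Prop :=
  Function.Bijective K.f ∧ Function.Bijective K.g

end Context

end MoritaTakeuchi

namespace MoritaTakeuchi

set_option linter.unusedSectionVars false

set_option maxSynthPendingDepth 6

/-! ### Colinear maps -/

section Colinear

variable {R : Type u} [CommRing R] {C : Type v} [AddCommGroup C] [Module R C] [Coalgebra R C]
  {V : Type w} [AddCommGroup V] [Module R V]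
  {W : Type x} [AddCommGroup W] [Module R W]
  {X : Type y} [AddCommGroup X] [Module R X]

/-! From a strict context to an equivalence. The functors are `V ↦ V □_C N` and `W ↦ W □_D M`, and
the unit is `v ↦ v₀ ⊗ g(v₁)`. Since `M` is flat, `(V □_C N) □_D M` sits inside `V ⊗ N ⊗ M` as the
intersection of two kernels, and the unit is studied there. It is injective because the coaction is
split by the counit and because purity of `N □_D M` makes `id_Q ⊗ g` injective for every module `Q`.
For surjectivity, let `t = ∑ v ⊗ n ⊗ m` be in the double cotensor product. The two cotensor
conditions, alternating with the two squares of the context, give `v₀ ⊗ g(v₁) ⊗ n ⊗ m = v ⊗ g(n₋₁) ⊗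
n₀ ⊗ m = v ⊗ n₀ ⊗ f(n₁) ⊗ m = v ⊗ n ⊗ f(m₋₁) ⊗ m₀ = v ⊗ n ⊗ m₀ ⊗ g(m₁)` (`rTensor_unitTensor`).
Hence `(id ⊗ g)(ρ(t))` vanishes modulo the image of the unit. Purity, applied to the quotient by
that image, cancels `g`, and the counit then shows that `t` is in the image
(`eq_zero_of_rTensor_eq_lTensor_rcoact`).

From an equivalence to a strict context. This is an Eilenberg–Watts argument. Morphisms `X ⊗ V → W`
are the `R`-linear maps `X → Hom(V, W)`, so an `R`-linear equivalence `F` commutes with tensoring by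
`R`-modules (`theta_isIso`). Applying `F` to the coaction `V → V ⊗ C` yields `β : F(V) → V ⊗ F(C)`.
For `V = C` this is a left coaction that makes `F(C)` a bicomodule. A comodule is the equalizer of
`V ⊗ C ⇉ V ⊗ C ⊗ C`, so `β` identifies `F(V)` with `V □_C F(C)` (`toCotensor_bijective`). Over a
flat coalgebra monomorphisms are injective; as `F` preserves them, `F(C)` is flat and the cotensor
products are pure. With a quasi-inverse `G`, set `N = F(C)` and `M = G(D)`; then `f` is `D ≅ FG(D) ≅
M □_C N` and `g` is `C ≅ GF(C) ≅ N □_D M`. The two squares are the triangle identities seen through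
the naturality of `β`. -/

theorem IsRightColinear.comp [RightComodule R C V] [RightComodule R C W] [RightComodule R C X]
    {g : W →ₗ[R] X} {f : V →ₗ[R] W} (hg : IsRightColinear R C g) (hf : IsRightColinear R C f) :
    IsRightColinear R C (g ∘ₗ f) := by
  unfold IsRightColinear at *
  rw [LinearMap.rTensor_comp, ← LinearMap.comp_assoc, hg, LinearMap.comp_assoc, hf,
    LinearMap.comp_assoc]

theorem IsLeftColinear.comp [LeftComodule R C V] [LeftComodule R C W] [LeftComodule R C X]
    {g : W →ₗ[R] X} {f : V →ₗ[R] W} (hg : IsLeftColinear R C g) (hf : IsLeftColinear R C f) :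
    IsLeftColinear R C (g ∘ₗ f) := by
  unfold IsLeftColinear at *
  rw [LinearMap.lTensor_comp, ← LinearMap.comp_assoc, hg, LinearMap.comp_assoc, hf,
    LinearMap.comp_assoc]

/-- Lets colinearity be checked after an embedding. It is applied mostly to inclusions of cotensor
products, where flatness of the coalgebra supplies the injectivity hypothesis. -/
theorem IsRightColinear.of_comp [RightComodule R C V] [RightComodule R C W] [RightComodule R C X]
    {g : W →ₗ[R] X} {f : V →ₗ[R] W} (hg : IsRightColinear R C g)
    (hi : Function.Injective (g.rTensor C)) (h : IsRightColinear R C (g ∘ₗ f)) :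
    IsRightColinear R C f := by
  unfold IsRightColinear at *
  refine LinearMap.ext fun v => hi ?_
  have h1 := LinearMap.congr_fun h v
  have h2 := LinearMap.congr_fun hg (f v)
  rw [LinearMap.rTensor_comp] at h1
  exact h2.symm.trans h1

theorem IsLeftColinear.of_comp [LeftComodule R C V] [LeftComodule R C W] [LeftComodule R C X]
    {g : W →ₗ[R] X} {f : V →ₗ[R] W} (hg : IsLeftColinear R C g)
    (hi : Function.Injective (g.lTensor C)) (h : IsLeftColinear R C (g ∘ₗ f)) :
    IsLeftColinear R C f := by
  unfold IsLeftColinear at *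
  refine LinearMap.ext fun v => hi ?_
  have h1 := LinearMap.congr_fun h v
  have h2 := LinearMap.congr_fun hg (f v)
  rw [LinearMap.lTensor_comp] at h1
  exact h2.symm.trans h1

theorem isRightColinear_mk [RightComodule R C V] (x : X) :
    IsRightColinear R C (TensorProduct.mk R X V x) :=
  tensorRight_aux R C X V (rcoact R C V) x

/-- The maps `v ↦ x ⊗ v` are colinear and their images span `X ⊗ V`, so they detect colinearity. -/
theorem isRightColinear_of_mk [RightComodule R C V] [RightComodule R C W]
    {h : X ⊗[R] V →ₗ[R] W} (H : ∀ x, IsRightColinear R C (h ∘ₗ TensorProduct.mk R X V x)) :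
    IsRightColinear R C h := by
  refine TensorProduct.ext' fun x v => ?_
  have h1 := LinearMap.congr_fun (H x) v
  have h2 := LinearMap.congr_fun (isRightColinear_mk (R := R) (C := C) (V := V) x) v
  rw [LinearMap.rTensor_comp] at h1
  exact h1.trans (congrArg (h.rTensor C) h2.symm)

theorem isRightColinear_rTensor [RightComodule R C V] (h : X →ₗ[R] W) :
    IsRightColinear R C (h.rTensor V) :=
  isRightColinear_of_mk fun x => isRightColinear_mk (C := C) (V := V) (h x)

theorem isRightColinear_lTensor [RightComodule R C V] [RightComodule R C W] {h : V →ₗ[R] W}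
    (hh : IsRightColinear R C h) : IsRightColinear R C (h.lTensor X) :=
  isRightColinear_of_mk fun x => (isRightColinear_mk x).comp hh

theorem isRightColinear_assoc [RightComodule R C V] :
    IsRightColinear R C (TensorProduct.assoc R X W V).toLinearMap := by
  refine isRightColinear_of_mk fun t => ?_
  induction t with
  | zero => rw [map_zero, LinearMap.comp_zero]; simp [IsRightColinear]
  | add a b ha hb =>
    rw [map_add, LinearMap.comp_add]
    unfold IsRightColinear at *
    rw [LinearMap.comp_add, ha, hb, LinearMap.rTensor_add, LinearMap.add_comp]
  | tmul x w => exact (isRightColinear_mk x).comp (isRightColinear_mk w)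

theorem isRightColinear_rcoact [RightComodule R C V] : IsRightColinear R C (rcoact R C V) := by
  have h := RightComodule.coassoc (R := R) (C := C) (M := V)
  refine LinearMap.ext fun v => (TensorProduct.assoc R V C C).injective ?_
  refine Eq.trans ?_ (LinearMap.congr_fun h v).symm
  exact LinearEquiv.apply_symm_apply _ _

theorem rcoact_injective [RightComodule R C V] : Function.Injective (rcoact R C V) := by
  refine Function.HasLeftInverse.injective ⟨(TensorProduct.rid R V).toLinearMap ∘ₗ
    (Coalgebra.counit (R := R) (A := C)).lTensor V, fun v => ?_⟩
  exact LinearMap.congr_fun (RightComodule.counit_coact (R := R) (C := C) (M := V)) v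

theorem rTensor_lTensor_apply (f : V →ₗ[R] W) {Y : Type z} [AddCommGroup Y] [Module R Y]
    (g : X →ₗ[R] Y) (t : V ⊗[R] X) :
    f.rTensor Y (g.lTensor V t) = g.lTensor W (f.rTensor X t) :=
  (LinearMap.congr_fun (LinearMap.rTensor_comp_lTensor _ f g) t).trans
    (LinearMap.congr_fun (LinearMap.lTensor_comp_rTensor _ f g) t).symm

/-- The surjectivity criterion behind `unit_bijective`, with `p` the projection onto the cokernel of
`f`. Applying `p` kills the left side, injectivity of `id_X ⊗ g` leaves `(p ⊗ id)(ρ(t)) = 0`, and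
the counit turns this into `p t = 0`. The kernel of `p` need not be a subcomodule. -/
theorem eq_zero_of_rTensor_eq_lTensor_rcoact [RightComodule R C W] {Y : Type z} [AddCommGroup Y]
    [Module R Y] {f : V →ₗ[R] W} (p : W →ₗ[R] X) (hp : p ∘ₗ f = 0) {g : C →ₗ[R] Y}
    (hg : Function.Injective (g.lTensor X)) (s : V ⊗[R] Y) (t : W)
    (h : f.rTensor Y s = g.lTensor W (rcoact R C W t)) : p t = 0 := by
  have h' := congrArg (p.rTensor Y) h
  rw [← LinearMap.comp_apply, ← LinearMap.rTensor_comp, hp, LinearMap.rTensor_zero,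
    LinearMap.zero_apply, rTensor_lTensor_apply] at h'
  have h1 := congrArg ((Coalgebra.counit (R := R) (A := C)).lTensor X)
    (hg (h'.symm.trans (map_zero _).symm))
  rw [← rTensor_lTensor_apply, map_zero] at h1
  have h2 : p (TensorProduct.rid R W ((Coalgebra.counit (R := R) (A := C)).lTensor W
      (rcoact R C W t))) = p t :=
    congrArg p (LinearMap.congr_fun (RightComodule.counit_coact (R := R) (C := C) (M := W)) t)
  have h3 : p ∘ₗ (TensorProduct.rid R W).toLinearMap =
      (TensorProduct.rid R X).toLinearMap ∘ₗ p.rTensor R := by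
    ext; simp
  rw [← h2]
  refine (LinearMap.congr_fun h3 _).trans ?_
  rw [LinearMap.comp_apply, h1, map_zero]

end Colinear

/-! ### The functor given by the cotensor product with a bicomodule -/

section CotensorCat

variable {R : Type u} [CommRing R] {C : Type u} [AddCommGroup C] [Module R C] [Coalgebra R C]
  {D : Type u} [AddCommGroup D] [Module R D] [Coalgebra R D] [Module.Flat R D]
  (N : Type u) [AddCommGroup N] [Module R N] [LeftComodule R C N] [RightComodule R D N]
  [IsBicomodule R C D N]

theorem isRightColinear_mapLeft {V W : Type u} [AddCommGroup V] [Module R V] [RightComodule R C V]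
    [AddCommGroup W] [Module R W] [RightComodule R C W] (h : V →ₗ[R] W)
    (hh : IsRightColinear R C h) : IsRightColinear R D (Cotensor.mapLeft N h hh) := by
  refine IsRightColinear.of_comp (cotensor_subtype_rightColinear (R := R) (C := C) (D := D))
    (rTensor_subtype_injective D _) ?_
  exact (isRightColinear_rTensor h).comp
    (cotensor_subtype_rightColinear (R := R) (C := C) (D := D) (M := V))

/-- The functor `- □_C N : 𝓜^C ⥤ 𝓜^D` given by a `C`-`D`-bicomodule `N`. -/
noncomputable def cotensorFunctor : RightComodCat R C ⥤ RightComodCat R D where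
  obj V := ⟨Cotensor R C V.carrier N⟩
  map h := ⟨Cotensor.mapLeft N h.1 h.2, isRightColinear_mapLeft N h.1 h.2⟩
  map_id V := Subtype.ext <| LinearMap.ext fun t => Subtype.ext <|
    LinearMap.congr_fun (LinearMap.rTensor_id N V.carrier) t.1
  map_comp f g := Subtype.ext <| LinearMap.ext fun t => Subtype.ext <|
    LinearMap.congr_fun (LinearMap.rTensor_comp N g.1 f.1) t.1

instance : (cotensorFunctor (R := R) (C := C) (D := D) N).Additive where
  map_add {_ _ f g} := Subtype.ext <| LinearMap.ext fun t => Subtype.ext <|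
    LinearMap.congr_fun (LinearMap.rTensor_add N f.1 g.1) t.1

instance : (cotensorFunctor (R := R) (C := C) (D := D) N).Linear R where
  map_smul f r := Subtype.ext <| LinearMap.ext fun t => Subtype.ext <|
    LinearMap.congr_fun (LinearMap.rTensor_smul N r f.1) t.1

/-- A bijective morphism of comodules is an isomorphism. -/
noncomputable def isoOfBijective {V W : RightComodCat R C} (f : V ⟶ W)
    (hf : Function.Bijective f.1) : V ≅ W where
  hom := f
  inv := ⟨(LinearEquiv.ofBijective f.1 hf).symm.toLinearMap, by
    have h : _ = _ := f.2
    set e := LinearEquiv.ofBijective f.1 hf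
    refine LinearMap.ext fun w => ?_
    obtain ⟨v, rfl⟩ := e.surjective w
    have h1 : rcoact R C W.carrier (e v) = e.toLinearMap.rTensor C (rcoact R C V.carrier v) :=
      LinearMap.congr_fun h v
    have h2 : e.symm.toLinearMap.rTensor C ∘ₗ e.toLinearMap.rTensor C = LinearMap.id := by
      rw [← LinearMap.rTensor_comp, LinearEquiv.symm_comp, LinearMap.rTensor_id]
    rw [LinearMap.comp_apply, LinearMap.comp_apply, h1]
    exact (congrArg _ (e.symm_apply_apply v)).trans (LinearMap.congr_fun h2 _).symm⟩
  hom_inv_id := Subtype.ext <| LinearMap.ext fun v =>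
    (LinearEquiv.ofBijective f.1 hf).symm_apply_apply v
  inv_hom_id := Subtype.ext <| LinearMap.ext fun v =>
    (LinearEquiv.ofBijective f.1 hf).apply_symm_apply v

end CotensorCat

/-! ### The equivalence given by a strict context -/

namespace MoritaTakeuchiContext

attribute [instance] addCommGroupM moduleM leftM rightM bicomoduleM addCommGroupN moduleN leftN
  rightN bicomoduleN flatM flatN

variable {R : Type u} [CommRing R]
  {D : Type u} [AddCommGroup D] [Module R D] [Coalgebra R D] [Module.Flat R D]
  {C : Type u} [AddCommGroup C] [Module R C] [Coalgebra R C] [Module.Flat R C]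
  (K : MoritaTakeuchiContext R D C)

/-- The context with the two sides interchanged. -/
def swap : MoritaTakeuchiContext R C D where
  M := K.N
  N := K.M
  pureMN := K.pureNM
  pureNM := K.pureMN
  f := K.g
  f_left := K.g_left
  f_right := K.g_right
  g := K.f
  g_left := K.f_left
  g_right := K.f_right
  diagramM := K.diagramN
  diagramN := K.diagramM

/-- The map `f` with values in `M ⊗ N`. -/
def fTensor : D →ₗ[R] K.M ⊗[R] K.N := (Cotensor R C K.M K.N).subtype ∘ₗ K.f

/-- The map `g` with values in `N ⊗ M`. -/
def gTensor : C →ₗ[R] K.N ⊗[R] K.M := (Cotensor R D K.N K.M).subtype ∘ₗ K.g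

theorem gTensor_left : IsLeftColinear R C K.gTensor :=
  IsLeftColinear.comp cotensor_subtype_leftColinear K.g_left

theorem gTensor_right : IsRightColinear R C K.gTensor :=
  IsRightColinear.comp cotensor_subtype_rightColinear K.g_right

/-- The square on `M` pushed into `M ⊗ N ⊗ M`: `m₀ ⊗ g(m₁) = f(m₋₁) ⊗ m₀`. -/
theorem lTensor_gTensor_rcoact (m : K.M) :
    K.gTensor.lTensor K.M (rcoact R C K.M m) =
      TensorProduct.assoc R K.M K.N K.M (K.fTensor.rTensor K.M (lcoact R D K.M m)) := by
  have h := congrArg (Cotensor.inclRight R C D K.M K.N K.M) (K.diagramM m)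
  rw [Cotensor.inclRight_assoc] at h
  rw [gTensor, fTensor, LinearMap.lTensor_comp, LinearMap.rTensor_comp]
  exact h

theorem lTensor_fTensor_rcoact (n : K.N) :
    K.fTensor.lTensor K.N (rcoact R D K.N n) =
      TensorProduct.assoc R K.N K.M K.N (K.gTensor.rTensor K.N (lcoact R C K.N n)) :=
  K.swap.lTensor_gTensor_rcoact n

/-- The map `n ⊗ d ⊗ m ↦ n ⊗ f(d) ⊗ m`. -/
noncomputable def insertF : K.N ⊗[R] (D ⊗[R] K.M) →ₗ[R] (K.N ⊗[R] K.M) ⊗[R] (K.N ⊗[R] K.M) :=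
  (TensorProduct.assoc R K.N K.M (K.N ⊗[R] K.M)).symm.toLinearMap ∘ₗ
    ((TensorProduct.assoc R K.M K.N K.M).toLinearMap ∘ₗ K.fTensor.rTensor K.M).lTensor K.N

/-- In elements, `n ⊗ m₀ ⊗ g(m₁) = n ⊗ f(m₋₁) ⊗ m₀`: the square on `M` with a spectator `n`. -/
theorem lTensor_gTensor_rcoact_tensor :
    K.gTensor.lTensor (K.N ⊗[R] K.M) ∘ₗ rcoact R C (K.N ⊗[R] K.M) =
      K.insertF ∘ₗ (lcoact R D K.M).lTensor K.N := by
  refine TensorProduct.ext' fun n m => ?_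
  have h := congrArg (fun t => (TensorProduct.assoc R K.N K.M (K.N ⊗[R] K.M)).symm (n ⊗ₜ t))
    (K.lTensor_gTensor_rcoact m)
  refine Eq.trans ?_ h
  change K.gTensor.lTensor (K.N ⊗[R] K.M) ((TensorProduct.assoc R K.N K.M C).symm
    (n ⊗ₜ rcoact R C K.M m)) = _
  generalize rcoact R C K.M m = q
  induction q with
  | zero => simp
  | add a b ha hb => simp only [TensorProduct.tmul_add, map_add, ha, hb]
  | tmul d m => simp

/-- In elements, `g(n₋₁) ⊗ n₀ ⊗ m = n₀ ⊗ f(n₁) ⊗ m`: the square on `N` with a spectator `m`. Both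
this and the preceding identity end in `insertF`, so their difference factors through the map that
defines `N □_D M`. -/
theorem rTensor_gTensor_lcoact_tensor :
    K.gTensor.rTensor (K.N ⊗[R] K.M) ∘ₗ lcoact R C (K.N ⊗[R] K.M) =
      K.insertF ∘ₗ (TensorProduct.assoc R K.N D K.M).toLinearMap ∘ₗ
        (rcoact R D K.N).rTensor K.M := by
  refine TensorProduct.ext' fun n m => ?_
  let a : K.N ⊗[R] (K.M ⊗[R] K.N) →ₗ[R] (K.N ⊗[R] K.M) ⊗[R] (K.N ⊗[R] K.M) :=
    (TensorProduct.assoc R K.N K.M (K.N ⊗[R] K.M)).symm.toLinearMap ∘ₗ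
      ((TensorProduct.assoc R K.M K.N K.M).toLinearMap ∘ₗ
        (TensorProduct.mk R (K.M ⊗[R] K.N) K.M).flip m).lTensor K.N
  have h := congrArg a (K.lTensor_fTensor_rcoact n)
  have h1 : ∀ q : C ⊗[R] K.N, K.gTensor.rTensor (K.N ⊗[R] K.M)
      (TensorProduct.assoc R C K.N K.M (q ⊗ₜ m)) =
      a (TensorProduct.assoc R K.N K.M K.N (K.gTensor.rTensor K.N q)) := by
    intro q
    induction q with
    | zero => simp
    | add a b ha hb => simp only [TensorProduct.add_tmul, map_add, ha, hb]
    | tmul c n =>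
      simp only [TensorProduct.assoc_tmul, LinearMap.rTensor_tmul]
      generalize K.gTensor c = p
      induction p with
      | zero => simp
      | add a b ha hb => simp only [TensorProduct.add_tmul, map_add, ha, hb]
      | tmul n' m' => simp [a]
  have h2 : ∀ q : K.N ⊗[R] D, K.insertF (TensorProduct.assoc R K.N D K.M (q ⊗ₜ m)) =
      a (K.fTensor.lTensor K.N q) := by
    intro q
    induction q with
    | zero => simp
    | add a b ha hb => simp only [TensorProduct.add_tmul, map_add, ha, hb]
    | tmul n d => simp [a, insertF]
  exact (h1 _).trans (h.symm.trans (h2 _).symm)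

/-! ### The unit `V → (V □_C N) □_D M` and its bijectivity -/

section Unit

variable (V : Type u) [AddCommGroup V] [Module R V] [RightComodule R C V]

/-- The map `V → V ⊗ N ⊗ M`, `v ↦ v₀ ⊗ g(v₁)`. -/
noncomputable def unitTensor : V →ₗ[R] V ⊗[R] (K.N ⊗[R] K.M) :=
  K.gTensor.lTensor V ∘ₗ rcoact R C V

/-- The condition over `C` comes from coassociativity of `V` and left colinearity of `g`; the
condition over `D` holds because `g` takes values in `N □_D M`. -/
theorem unitTensor_mem (v : V) :
    K.unitTensor V v ∈ LinearMap.range (Cotensor.inclLeft R C D V K.N K.M) := by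
  rw [Cotensor.range_inclLeft]
  constructor
  · have h := LinearMap.congr_fun (cotensorMap_lTensor V C K.gTensor K.gTensor_left)
      (rcoact R C V v)
    have h0 : cotensorMap R C V C (rcoact R C V v) = 0 := (Cotensor.rightUnit R C V v).2
    rw [LinearMap.comp_apply, LinearMap.comp_apply, h0, map_zero] at h
    exact h
  · have h : cotensorMap R D K.N K.M ∘ₗ K.gTensor = 0 := LinearMap.ext fun c => (K.g c).2
    change (cotensorMap R D K.N K.M).lTensor V (K.gTensor.lTensor V (rcoact R C V v)) = 0
    rw [← LinearMap.comp_apply, ← LinearMap.lTensor_comp, h, LinearMap.lTensor_zero,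
      LinearMap.zero_apply]

/-- The unit `V → (V □_C N) □_D M`. -/
noncomputable def unit : V →ₗ[R] Cotensor R D (Cotensor R C V K.N) K.M :=
  (LinearEquiv.ofInjective _ (Cotensor.inclLeft_injective R C D V K.N K.M)).symm.toLinearMap ∘ₗ
    (K.unitTensor V).codRestrict _ (K.unitTensor_mem V)

theorem inclLeft_unit (v : V) :
    Cotensor.inclLeft R C D V K.N K.M (K.unit V v) = K.unitTensor V v :=
  congrArg Subtype.val ((LinearEquiv.ofInjective _
    (Cotensor.inclLeft_injective R C D V K.N K.M)).apply_symm_apply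
      ((K.unitTensor V).codRestrict _ (K.unitTensor_mem V) v))

theorem inclLeft_right : IsRightColinear R C (Cotensor.inclLeft R C D V K.N K.M) :=
  isRightColinear_assoc.comp ((isRightColinear_rTensor _).comp cotensor_subtype_rightColinear)

theorem unit_right : IsRightColinear R C (K.unit V) := by
  refine IsRightColinear.of_comp (K.inclLeft_right V)
    (Module.Flat.rTensor_preserves_injective_linearMap _ (Cotensor.inclLeft_injective ..)) ?_
  rw [show Cotensor.inclLeft R C D V K.N K.M ∘ₗ K.unit V = K.unitTensor V from
    LinearMap.ext (K.inclLeft_unit V)]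
  exact (isRightColinear_lTensor K.gTensor_right).comp isRightColinear_rcoact

variable {K}

/-- This is where purity enters: no flatness of `Q` is available, since `Q` will also be a cokernel.
-/
theorem lTensor_gTensor_injective (hg : Function.Bijective K.g) (Q : Type u) [AddCommGroup Q]
    [Module R Q] : Function.Injective (K.gTensor.lTensor Q) := by
  rw [gTensor, LinearMap.lTensor_comp, LinearMap.coe_comp]
  refine Function.Injective.comp ?_ ((LinearEquiv.ofBijective K.g hg).lTensor Q).injective
  exact (LinearMap.lTensor_inj_iff_rTensor_inj Q _).2 (K.pureNM Q)

theorem unit_injective (hg : Function.Bijective K.g) : Function.Injective (K.unit V) := by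
  have h : Function.Injective (K.unitTensor V) :=
    (lTensor_gTensor_injective hg V).comp rcoact_injective
  rw [← show Cotensor.inclLeft R C D V K.N K.M ∘ₗ K.unit V = K.unitTensor V from
    LinearMap.ext (K.inclLeft_unit V)] at h
  exact Function.Injective.of_comp (f := Cotensor.inclLeft R C D V K.N K.M) h

variable (K)

/-- The chain of equalities that moves `g` from the coaction of `V` to that of `M`: `h1` passes from
`V` to `N`, the two squares exchange `g` and `f`, and `h2` passes from `N` to `M`. -/
theorem rTensor_unitTensor (s : V ⊗[R] (K.N ⊗[R] K.M))
    (h1 : cotensorMap R C V (K.N ⊗[R] K.M) s = 0)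
    (h2 : (cotensorMap R D K.N K.M).lTensor V s = 0) :
    (K.unitTensor V).rTensor (K.N ⊗[R] K.M) s =
      K.gTensor.lTensor (V ⊗[R] (K.N ⊗[R] K.M)) (rcoact R C (V ⊗[R] (K.N ⊗[R] K.M)) s) := by
  let P := K.N ⊗[R] K.M
  let a := (TensorProduct.assoc R V P P).symm
  have e1 : (rcoact R C V).rTensor P s =
      (TensorProduct.assoc R V C P).symm ((lcoact R C P).lTensor V s) := by
    rw [LinearEquiv.eq_symm_apply]
    exact sub_eq_zero.1 h1
  have e2 : ∀ q : V ⊗[R] (C ⊗[R] P), (K.gTensor.lTensor V).rTensor P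
      ((TensorProduct.assoc R V C P).symm q) = a ((K.gTensor.rTensor P).lTensor V q) := by
    have : (K.gTensor.lTensor V).rTensor P ∘ₗ (TensorProduct.assoc R V C P).symm.toLinearMap =
        a.toLinearMap ∘ₗ (K.gTensor.rTensor P).lTensor V := by
      refine TensorProduct.ext' fun v t => ?_
      induction t with
      | zero => simp
      | add a b ha hb => simp only [TensorProduct.tmul_add, map_add, ha, hb]
      | tmul c p => simp [a]
    exact LinearMap.congr_fun this
  have e3 : ∀ q : V ⊗[R] (P ⊗[R] C), K.gTensor.lTensor (V ⊗[R] P)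
      ((TensorProduct.assoc R V P C).symm q) = a ((K.gTensor.lTensor P).lTensor V q) := by
    have : K.gTensor.lTensor (V ⊗[R] P) ∘ₗ (TensorProduct.assoc R V P C).symm.toLinearMap =
        a.toLinearMap ∘ₗ (K.gTensor.lTensor P).lTensor V := by
      refine TensorProduct.ext' fun v t => ?_
      induction t with
      | zero => simp
      | add a b ha hb => simp only [TensorProduct.tmul_add, map_add, ha, hb]
      | tmul c p => simp [a]
    exact LinearMap.congr_fun this
  -- The defect between the left and right coactions of `N ⊗ M`, after `g`, is `insertF` of the
  -- cotensor defect over `D`; `h2` kills it.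
  have e4 : K.gTensor.rTensor P ∘ₗ lcoact R C P - K.gTensor.lTensor P ∘ₗ rcoact R C P =
      K.insertF ∘ₗ cotensorMap R D K.N K.M := by
    rw [K.rTensor_gTensor_lcoact_tensor, K.lTensor_gTensor_rcoact_tensor, cotensorMap,
      LinearMap.comp_sub]
  have e5 := congrArg (fun k => k.lTensor V s) e4
  simp only [LinearMap.lTensor_sub, LinearMap.sub_apply, LinearMap.lTensor_comp,
    LinearMap.comp_apply, h2, map_zero, sub_eq_zero] at e5
  rw [unitTensor, LinearMap.rTensor_comp, LinearMap.comp_apply]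
  refine (congrArg _ e1).trans ((e2 _).trans ((congrArg a e5).trans (e3 _).symm))

theorem rTensor_unit (t : Cotensor R D (Cotensor R C V K.N) K.M) :
    (K.unit V).rTensor (K.N ⊗[R] K.M) (Cotensor.inclLeft R C D V K.N K.M t) =
      K.gTensor.lTensor _ (rcoact R C (Cotensor R D (Cotensor R C V K.N) K.M) t) := by
  let i := Cotensor.inclLeft R C D V K.N K.M
  have hi : Function.Injective (i.rTensor (K.N ⊗[R] K.M)) :=
    Module.Flat.rTensor_preserves_injective_linearMap _ (Cotensor.inclLeft_injective ..)
  refine hi ?_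
  have hm : i t ∈ LinearMap.range i := ⟨t, rfl⟩
  rw [Cotensor.range_inclLeft] at hm
  have h := K.rTensor_unitTensor V (i t) hm.1 hm.2
  have hc := LinearMap.congr_fun (K.inclLeft_right V) t
  rw [rTensor_lTensor_apply]
  rw [← show i ∘ₗ K.unit V = K.unitTensor V from LinearMap.ext (K.inclLeft_unit V),
    LinearMap.rTensor_comp] at h
  exact h.trans (congrArg _ hc)

variable {K}

theorem unit_bijective (hg : Function.Bijective K.g) : Function.Bijective (K.unit V) := by
  refine ⟨unit_injective V hg, fun t => ?_⟩
  -- The criterion is applied with `X` the cokernel of the unit and with `s` the image of `t` in `V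
  -- ⊗ N ⊗ M`, regrouped by no more than the inclusion.
  exact (Submodule.Quotient.mk_eq_zero _).1 (eq_zero_of_rTensor_eq_lTensor_rcoact
    (LinearMap.range (K.unit V)).mkQ (LinearMap.range_mkQ_comp _)
    (lTensor_gTensor_injective hg _) _ t (K.rTensor_unit V t))

end Unit

/-- The natural isomorphism `V ≅ (V □_C N) □_D M`. -/
noncomputable def unitIso {K : MoritaTakeuchiContext R D C} (hg : Function.Bijective K.g) :
    𝟭 (RightComodCat R C) ≅ cotensorFunctor (D := D) K.N ⋙ cotensorFunctor (D := C) K.M :=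
  NatIso.ofComponents (fun V => isoOfBijective
    (W := (cotensorFunctor (D := D) K.N ⋙ cotensorFunctor (D := C) K.M).obj V)
    ⟨K.unit V.carrier, K.unit_right V.carrier⟩ (unit_bijective V.carrier hg)) fun {V W} h => by
      refine Subtype.ext (LinearMap.ext fun v =>
        Cotensor.inclLeft_injective R C D W.carrier K.N K.M ?_)
      have h1 := K.inclLeft_unit W.carrier (h.1 v)
      have h2 : ∀ t, Cotensor.inclLeft R C D W.carrier K.N K.M
          (((cotensorFunctor (D := D) K.N ⋙ cotensorFunctor (D := C) K.M).map h).1 t) =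
          h.1.rTensor (K.N ⊗[R] K.M) (Cotensor.inclLeft R C D V.carrier K.N K.M t) := by
        intro t
        change TensorProduct.assoc R W.carrier K.N K.M ((Cotensor R C W.carrier K.N).subtype.rTensor
          K.M ((Cotensor.mapLeft K.N h.1 h.2).rTensor K.M t.1)) =
          h.1.rTensor (K.N ⊗[R] K.M) (TensorProduct.assoc R V.carrier K.N K.M
            ((Cotensor R C V.carrier K.N).subtype.rTensor K.M t.1))
        generalize t.1 = q
        have e : (TensorProduct.assoc R W.carrier K.N K.M).toLinearMap ∘ₗ
            (h.1.rTensor K.N).rTensor K.M = h.1.rTensor (K.N ⊗[R] K.M) ∘ₗ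
              (TensorProduct.assoc R V.carrier K.N K.M).toLinearMap := by
          ext; simp
        have e' := LinearMap.congr_fun e ((Cotensor R C V.carrier K.N).subtype.rTensor K.M q)
        refine Eq.trans ?_ e'
        have e2 : (Cotensor R C W.carrier K.N).subtype.rTensor K.M ∘ₗ
            (Cotensor.mapLeft K.N h.1 h.2).rTensor K.M = (h.1.rTensor K.N).rTensor K.M ∘ₗ
            (Cotensor R C V.carrier K.N).subtype.rTensor K.M := by
          rw [← LinearMap.rTensor_comp, ← LinearMap.rTensor_comp]; rfl
        exact congrArg _ (LinearMap.congr_fun e2 q)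
      refine h1.trans (Eq.trans ?_ (h2 (K.unit V.carrier v)).symm)
      rw [K.inclLeft_unit]
      have h3 : rcoact R C W.carrier (h.1 v) = h.1.rTensor C (rcoact R C V.carrier v) :=
        LinearMap.congr_fun h.2 v
      change K.gTensor.lTensor W.carrier (rcoact R C W.carrier (h.1 v)) = _
      rw [h3]
      exact (rTensor_lTensor_apply _ _ _).symm

theorem IsStrict.moritaTakeuchiEquivalent {K : MoritaTakeuchiContext R D C} (hK : K.IsStrict) :
    MoritaTakeuchiEquivalent R C D :=
  -- `Equivalence.mk` corrects the unit itself, so the two isomorphisms need not satisfy a triangle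
  -- identity. The second is the unit of the swapped context, which uses bijectivity of `f`.
  ⟨CategoryTheory.Equivalence.mk (cotensorFunctor K.N) (cotensorFunctor K.M) (unitIso hK.2)
    (unitIso (K := K.swap) hK.1).symm,
    inferInstanceAs (cotensorFunctor (R := R) (C := C) (D := D) K.N).Additive,
    inferInstanceAs ((cotensorFunctor (R := R) (C := C) (D := D) K.N).Linear R)⟩

end MoritaTakeuchiContext

/-! ### Tensoring comodules with modules -/

namespace RightComodCat

variable {R : Type u} [CommRing R] {C : Type u} [AddCommGroup C] [Module R C] [Coalgebra R C]

variable (R C) in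
/-- The coalgebra `C` as an object of `𝓜^C`. -/
abbrev reg : RightComodCat R C := ⟨C⟩

/-- The comodule `X ⊗ V`, for an `R`-module `X` and a comodule `V`. -/
abbrev tens (X : Type u) [AddCommGroup X] [Module R X] (V : RightComodCat R C) :
    RightComodCat R C := ⟨X ⊗[R] V.carrier⟩

theorem hom_ext_apply {V W : RightComodCat R C} {f g : V ⟶ W} (h : ∀ v, f.1 v = g.1 v) : f = g :=
  Subtype.ext (LinearMap.ext h)

theorem congr_hom {V W : RightComodCat R C} {f g : V ⟶ W} (h : f = g) (v : V.carrier) :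
    f.1 v = g.1 v := by rw [h]

variable {X : Type u} [AddCommGroup X] [Module R X] {Y : Type u} [AddCommGroup Y] [Module R Y]
  {V W : RightComodCat R C}

/-- The morphisms `V → X ⊗ V`, `v ↦ x ⊗ v`. -/
def ins (V : RightComodCat R C) : X →ₗ[R] (V ⟶ tens X V) where
  toFun x := ⟨TensorProduct.mk R X V.carrier x, isRightColinear_mk x⟩
  map_add' _ _ := Subtype.ext (map_add _ _ _)
  map_smul' _ _ := Subtype.ext (map_smul _ _ _)

/-- The morphism `X ⊗ V → W` given by a linear family of morphisms `V → W`. -/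
def desc (p : X →ₗ[R] (V ⟶ W)) : tens X V ⟶ W :=
  ⟨TensorProduct.lift ((comHom R C V.carrier W.carrier).subtype ∘ₗ p),
    isRightColinear_of_mk fun x => (p x).2⟩

theorem ins_desc (p : X →ₗ[R] (V ⟶ W)) (x : X) : ins V x ≫ desc p = p x :=
  hom_ext_apply fun _ => rfl

theorem ins_hom_ext {f g : tens X V ⟶ W} (h : ∀ x : X, ins V x ≫ f = ins V x ≫ g) : f = g :=
  Subtype.ext (TensorProduct.ext' fun x v => congr_hom (h x) v)

variable (V) in
/-- The morphism `h ⊗ id : X ⊗ V → Y ⊗ V`. -/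
def map₁ (h : X →ₗ[R] Y) : tens X V ⟶ tens Y V := ⟨h.rTensor V.carrier, isRightColinear_rTensor h⟩

variable (X) in
/-- The morphism `id ⊗ f : X ⊗ V → X ⊗ W`. -/
def map₂ (f : V ⟶ W) : tens X V ⟶ tens X W := ⟨f.1.lTensor X, isRightColinear_lTensor f.2⟩

theorem ins_map₁ (h : X →ₗ[R] Y) (x : X) : ins V x ≫ map₁ V h = ins V (h x) :=
  hom_ext_apply fun _ => rfl

theorem ins_map₂ (f : V ⟶ W) (x : X) : ins V x ≫ map₂ X f = f ≫ ins W x :=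
  hom_ext_apply fun _ => rfl

theorem map₁_comp {Z : Type u} [AddCommGroup Z] [Module R Z] (h : X →ₗ[R] Y) (k : Y →ₗ[R] Z) :
    map₁ V (k ∘ₗ h) = map₁ V h ≫ map₁ V k :=
  Subtype.ext (LinearMap.rTensor_comp _ _ _)

theorem map₁_id : map₁ V (LinearMap.id : X →ₗ[R] X) = 𝟙 _ :=
  Subtype.ext (LinearMap.rTensor_id _ _)

theorem map₂_comp {Z : RightComodCat R C} (f : V ⟶ W) (g : W ⟶ Z) :
    map₂ X (f ≫ g) = map₂ X f ≫ map₂ X g :=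
  Subtype.ext (LinearMap.lTensor_comp _ _ _)

variable (V) in
/-- The coaction of `V` as a morphism `V → V ⊗ C`. -/
def rho : V ⟶ tens V.carrier (reg R C) := ⟨rcoact R C V.carrier, isRightColinear_rcoact⟩

theorem rho_naturality (f : V ⟶ W) : f ≫ rho W = rho V ≫ map₁ (reg R C) f.1 :=
  Subtype.ext f.2

variable (X Y V) in
/-- The associativity isomorphism `X ⊗ (Y ⊗ V) → (X ⊗ Y) ⊗ V`. -/
def assocInv : tens X (tens Y V) ⟶ tens (X ⊗[R] Y) V :=
  ⟨(TensorProduct.assoc R X Y V.carrier).symm.toLinearMap, by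
    refine isRightColinear_of_mk fun x => isRightColinear_of_mk fun y => ?_
    exact isRightColinear_mk (x ⊗ₜ[R] y)⟩

theorem ins_assocInv (x : X) :
    ins (tens Y V) x ≫ assocInv X Y V = map₁ V (TensorProduct.mk R X Y x) := by
  refine ins_hom_ext fun y => hom_ext_apply fun v => ?_
  exact TensorProduct.assoc_symm_tmul x y v

theorem rho_map₁_rho :
    rho V ≫ map₁ (reg R C) (rcoact R C V.carrier) =
      rho V ≫ map₂ V.carrier (rho (reg R C)) ≫ assocInv V.carrier C (reg R C) := by
  refine hom_ext_apply fun v => (TensorProduct.assoc R V.carrier C C).injective ?_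
  refine (LinearMap.congr_fun (RightComodule.coassoc (R := R) (C := C) (M := V.carrier)) v).trans ?_
  exact (LinearEquiv.apply_symm_apply _ _).symm

variable (V) in
/-- A comodule `V` is the equalizer of the two maps `V ⊗ C → V ⊗ C ⊗ C`. -/
noncomputable def rhoIsLimit : Limits.IsLimit (Limits.Fork.ofι (rho V) (rho_map₁_rho (V := V))) :=
  Limits.Fork.IsLimit.mk' _ fun s => by
    let k : _ ⟶ tens V.carrier (reg R C) := s.ι
    have hk : ∀ w, (rcoact R C V.carrier).rTensor C (k.1 w) =
        (TensorProduct.assoc R V.carrier C C).symm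
          ((Coalgebra.comul (R := R) (A := C)).lTensor V.carrier (k.1 w)) :=
      congr_hom s.condition
    have hk' : ∀ w, k.1 w ∈ Cotensor R C V.carrier C := fun w =>
      sub_eq_zero.2 ((LinearEquiv.eq_symm_apply _).1 (hk w))
    let l := (Cotensor.rightUnit R C V.carrier).symm.toLinearMap ∘ₗ k.1.codRestrict _ hk'
    have hl : rcoact R C V.carrier ∘ₗ l = k.1 := LinearMap.ext fun w =>
      congrArg Subtype.val ((Cotensor.rightUnit R C V.carrier).apply_symm_apply
        (k.1.codRestrict _ hk' w))
    -- The counit splits the coaction, so this injectivity survives tensoring without flatness of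
    -- `C`.
    have hinj : Function.Injective ((rcoact R C V.carrier).rTensor C) := by
      refine Function.HasLeftInverse.injective ⟨((TensorProduct.rid R V.carrier).toLinearMap ∘ₗ
        (Coalgebra.counit (R := R) (A := C)).lTensor V.carrier).rTensor C, fun t => ?_⟩
      rw [← LinearMap.comp_apply, ← LinearMap.rTensor_comp, LinearMap.comp_assoc,
        RightComodule.counit_coact, LinearMap.rTensor_id, LinearMap.id_apply]
    refine ⟨⟨l, IsRightColinear.of_comp isRightColinear_rcoact hinj (by rw [hl]; exact k.2)⟩,
      Subtype.ext hl, fun {m} hm => hom_ext_apply fun w => rcoact_injective (R := R) (C := C) (V := V.carrier) ?_⟩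
    exact (congr_hom hm w).trans (LinearMap.congr_fun hl w).symm

/-! ### Monomorphisms and isomorphisms of comodules -/

theorem mono_of_injective {f : V ⟶ W} (hf : Function.Injective f.1) : Mono f where
  right_cancellation _ _ h := hom_ext_apply fun z => hf (congr_hom h z)

/-- Flatness of `C` makes the kernel a subcomodule. Its inclusion and the zero map agree after `f`,
hence are equal. -/
theorem injective_of_mono [Module.Flat R C] (f : V ⟶ W) [Mono f] : Function.Injective f.1 := by
  let K := LinearMap.ker f.1
  have hK : ∀ m : K, rcoact R C V.carrier m ∈ LinearMap.range (K.subtype.rTensor C) := by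
    intro m
    refine (Module.Flat.rTensor_exact C (LinearMap.exact_subtype_ker_map f.1) _).1 ?_
    have h := LinearMap.congr_fun f.2 m.1
    have h0 : f.1 m.1 = 0 := m.2
    rw [LinearMap.comp_apply, h0, map_zero] at h
    exact h.symm
  let : RightComodule R C K := subRight C K hK
  let i : (⟨K⟩ : RightComodCat R C) ⟶ V := ⟨K.subtype, subRightCoact_spec C K hK⟩
  have h0 : i ≫ f = 0 ≫ f := hom_ext_apply fun m => by
    rw [Limits.zero_comp]
    exact m.2
  have h1 := (cancel_mono f).1 h0
  exact LinearMap.ker_eq_bot.1 (LinearMap.ker_eq_bot'.2 fun m hm => congr_hom h1 ⟨m, hm⟩)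

theorem bijective_of_isIso (f : V ⟶ W) [IsIso f] : Function.Bijective f.1 := by
  refine Function.bijective_iff_has_inverse.2 ⟨(inv f).1, fun v => ?_, fun w => ?_⟩
  · exact congr_hom (IsIso.hom_inv_id f) v
  · exact congr_hom (IsIso.inv_hom_id f) w

end RightComodCat

/-! ### Linear equivalences preserve tensoring with modules -/

open RightComodCat

section Theta

variable {R : Type u} [CommRing R] {C : Type u} [AddCommGroup C] [Module R C] [Coalgebra R C]
  {D : Type u} [AddCommGroup D] [Module R D] [Coalgebra R D]
  (F : RightComodCat R C ⥤ RightComodCat R D) [F.Additive] [F.Linear R]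
  (X : Type u) [AddCommGroup X] [Module R X] {Y : Type u} [AddCommGroup Y] [Module R Y]
  (V : RightComodCat R C) {W : RightComodCat R C}

/-- The canonical morphism `X ⊗ F(V) → F(X ⊗ V)`. -/
def theta : tens X (F.obj V) ⟶ F.obj (tens X V) :=
  desc (F.mapLinearMap R ∘ₗ ins V)

variable {X}

theorem ins_theta (x : X) : ins (F.obj V) x ≫ theta F X V = F.map (ins V x) :=
  ins_desc _ x

variable {V}

theorem map₁_theta (h : X →ₗ[R] Y) :
    map₁ (F.obj V) h ≫ theta F Y V = theta F X V ≫ F.map (map₁ V h) := by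
  refine ins_hom_ext fun x => ?_
  rw [← Category.assoc, ins_map₁, ins_theta, ← Category.assoc, ins_theta, ← F.map_comp, ins_map₁]

theorem map₂_theta (f : V ⟶ W) :
    map₂ X (F.map f) ≫ theta F X W = theta F X V ≫ F.map (map₂ X f) := by
  refine ins_hom_ext fun x => ?_
  rw [← Category.assoc, ins_map₂, Category.assoc, ins_theta, ← Category.assoc, ins_theta,
    ← F.map_comp, ← F.map_comp, ins_map₂]

theorem map₂_theta_theta : map₂ X (theta F Y V) ≫ theta F X (tens Y V) ≫ F.map (assocInv X Y V) =
    assocInv X Y (F.obj V) ≫ theta F (X ⊗[R] Y) V := by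
  refine ins_hom_ext fun x => ?_
  rw [← Category.assoc, ins_map₂, Category.assoc, ← Category.assoc (ins _ x), ins_theta,
    ← F.map_comp, ins_assocInv, ← Category.assoc (ins _ x), ins_assocInv, map₁_theta]

variable [F.IsEquivalence]

variable {F} in
-- Joint epimorphy of the insertions `V → X ⊗ V` is a categorical property, so the equivalence `F`
-- preserves it.
theorem map_ins_hom_ext {Z : RightComodCat R D} {f g : F.obj (tens X V) ⟶ Z}
    (h : ∀ x : X, F.map (ins V x) ≫ f = F.map (ins V x) ≫ g) : f = g := by
  let i := F.objObjPreimageIso Z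
  obtain ⟨f', hf⟩ := F.map_surjective (f ≫ i.inv)
  obtain ⟨g', hg⟩ := F.map_surjective (g ≫ i.inv)
  have h' : f' = g' := ins_hom_ext fun x => F.map_injective <| by
    rw [F.map_comp, F.map_comp, hf, hg, ← Category.assoc, h, Category.assoc]
  rw [← cancel_mono i.inv, ← hf, ← hg, h']

/-- `X ⊗ V` represents linear families of morphisms out of `V` indexed by `X`, a property that an
`R`-linear equivalence preserves. -/
instance theta_isIso : IsIso (theta F X V) := by
  let i := F.objObjPreimageIso (tens X (F.obj V))
  let E : (V ⟶ F.objPreimage (tens X (F.obj V))) ≃ₗ[R] _ :=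
    LinearEquiv.ofBijective (F.mapLinearMap R) ⟨F.map_injective, F.map_surjective⟩
  -- The inverse is built by lifting through `F` the family of insertions `F(V) → X ⊗ F(V)`, whose
  -- target is first replaced by an isomorphic object in the image of `F`.
  let q := E.symm.toLinearMap ∘ₗ Linear.rightComp R (F.obj V) i.inv ∘ₗ ins (F.obj V)
  have hq : ∀ x, F.map (q x) = ins (F.obj V) x ≫ i.inv := fun x => E.apply_symm_apply _
  have h : ∀ x : X, F.map (ins V x) ≫ F.map (desc q) ≫ i.hom = ins (F.obj V) x := by
    intro x
    rw [← Category.assoc, ← F.map_comp, ins_desc, hq, Category.assoc, i.inv_hom_id,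
      Category.comp_id]
  refine ⟨F.map (desc q) ≫ i.hom, ins_hom_ext fun x => ?_, map_ins_hom_ext fun x => ?_⟩
  · rw [← Category.assoc, ins_theta, h, Category.comp_id]
  · rw [← Category.assoc, h, ins_theta, Category.comp_id]

/-! ### The Eilenberg–Watts bicomodule of a linear equivalence -/

variable (V)

/-- The map `F(V) → V ⊗ F(C)` induced by the coaction of `V`. -/
noncomputable def beta : F.obj V ⟶ tens V.carrier (F.obj (reg R C)) :=
  F.map (rho V) ≫ inv (theta F V.carrier (reg R C))

theorem beta_theta : beta F V ≫ theta F V.carrier (reg R C) = F.map (rho V) := by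
  rw [beta, Category.assoc, IsIso.inv_hom_id, Category.comp_id]

variable {V}

theorem beta_naturality (f : V ⟶ W) :
    F.map f ≫ beta F W = beta F V ≫ map₁ (F.obj (reg R C)) f.1 := by
  rw [← cancel_mono (theta F W.carrier (reg R C)), Category.assoc, beta_theta, Category.assoc,
    map₁_theta, ← Category.assoc, beta_theta, ← F.map_comp, ← F.map_comp, rho_naturality]

theorem theta_beta : theta F X V ≫ beta F (tens X V) =
    map₂ X (beta F V) ≫ assocInv X V.carrier (F.obj (reg R C)) := by
  refine ins_hom_ext fun x => ?_
  rw [← Category.assoc, ins_theta, beta_naturality, ← Category.assoc, ins_map₂, Category.assoc,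
    ins_assocInv]
  rfl

/-- Naturality of `β` at the coaction `V → V ⊗ C`, combined with the formula for `β` on `V ⊗ C`. For
`V = C` it is coassociativity of the left coaction; in general it puts `β` in the cotensor product.
-/
theorem beta_coassoc : beta F V ≫ map₁ (F.obj (reg R C)) (rcoact R C V.carrier) =
    beta F V ≫ map₂ V.carrier (beta F (reg R C)) ≫ assocInv V.carrier C (F.obj (reg R C)) := by
  have h := beta_naturality F (rho V)
  rw [← beta_theta, Category.assoc, theta_beta] at h
  exact h.symm

theorem beta_coassoc_apply (t : (F.obj V).carrier) :
    TensorProduct.assoc R V.carrier C (F.obj (reg R C)).carrier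
        ((rcoact R C V.carrier).rTensor (F.obj (reg R C)).carrier ((beta F V).1 t)) =
      (beta F (reg R C)).1.lTensor V.carrier ((beta F V).1 t) := by
  rw [← LinearEquiv.eq_symm_apply]
  exact congr_hom (beta_coassoc F (V := V)) t

/-- The left `C`-comodule structure of `F(C)`. -/
noncomputable instance leftComoduleObj : LeftComodule R C (F.obj (reg R C)).carrier where
  coact := (beta F (reg R C)).1
  coassoc := LinearMap.ext fun t => beta_coassoc_apply F (V := reg R C) t
  counit_coact := by
    let k : C →ₗ[R] R := Coalgebra.counit (R := R) (A := C)
    -- The counit law of `C` as an equation between morphisms `C → R ⊗ C`, which `F` and `theta`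
    -- carry over to `F(C)`.
    have h1 : rho (reg R C) ≫ map₁ (reg R C) k = ins (reg R C) (1 : R) :=
      hom_ext_apply fun c => Coalgebra.rTensor_counit_comul c
    have h2 : beta F (reg R C) ≫ map₁ (F.obj (reg R C)) k = ins (F.obj (reg R C)) (1 : R) := by
      rw [← cancel_mono (theta F R (reg R C)), Category.assoc, map₁_theta, ← Category.assoc,
        beta_theta, ← F.map_comp, ins_theta]
      exact congrArg F.map h1
    refine LinearMap.ext fun t => ?_
    exact (congrArg (TensorProduct.lid R _) (congr_hom h2 t)).trans
      ((TensorProduct.lid_tmul _ _).trans (one_smul _ _))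

/-- The left coaction is a morphism of right `D`-comodules, which is exactly the compatibility
required. -/
instance isBicomodule_obj : IsBicomodule R C D (F.obj (reg R C)).carrier where
  comm := by
    refine LinearMap.ext fun t => ?_
    let N := (F.obj (reg R C)).carrier
    have h : (TensorProduct.assoc R C N D).symm ((rcoact R D N).lTensor C (lcoact R C N t)) =
        (lcoact R C N).rTensor D (rcoact R D N t) :=
      LinearMap.congr_fun (beta F (reg R C)).2 t
    exact ((LinearEquiv.symm_apply_eq _).1 h).symm

theorem beta_mem (t : (F.obj V).carrier) :
    (beta F V).1 t ∈ Cotensor R C V.carrier (F.obj (reg R C)).carrier :=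
  sub_eq_zero.2 (beta_coassoc_apply F t)

variable (V) in
/-- The map `F(V) → V □_C F(C)`. -/
noncomputable def toCotensor :
    (F.obj V).carrier →ₗ[R] Cotensor R C V.carrier (F.obj (reg R C)).carrier :=
  (beta F V).1.codRestrict _ (beta_mem F)

theorem subtype_comp_toCotensor :
    (Cotensor R C V.carrier (F.obj (reg R C)).carrier).subtype ∘ₗ toCotensor F V =
      (beta F V).1 := rfl

/-! ### The isomorphism `F(V) ≅ V □_C F(C)`, flatness and purity -/

variable [Module.Flat R D]

theorem toCotensor_right : IsRightColinear R D (toCotensor F V) :=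
  IsRightColinear.of_comp (cotensor_subtype_rightColinear (C := C))
    (rTensor_subtype_injective D _) (beta F V).2

theorem map_injective_of_injective {f : V ⟶ W} (hf : Function.Injective f.1) :
    Function.Injective (F.map f).1 := by
  have := mono_of_injective hf
  exact injective_of_mono (F.map f)

theorem beta_injective : Function.Injective (beta F V).1 := by
  have h := map_injective_of_injective F (f := rho V) rcoact_injective
  rw [← beta_theta] at h
  exact Function.Injective.of_comp (f := (theta F V.carrier (reg R C)).1) h

theorem toCotensor_bijective : Function.Bijective (toCotensor F V) := by
  refine ⟨fun a b h => beta_injective F (congrArg Subtype.val h), fun t => ?_⟩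
  let N := F.obj (reg R C)
  let W : RightComodCat R D := ⟨Cotensor R C V.carrier N.carrier⟩
  let i : W ⟶ tens V.carrier N := ⟨(Cotensor R C V.carrier N.carrier).subtype,
    cotensor_subtype_rightColinear⟩
  have hi : i ≫ map₁ N (rcoact R C V.carrier) =
      i ≫ map₂ V.carrier (beta F (reg R C)) ≫ assocInv V.carrier C N :=
    hom_ext_apply fun t => by
      have h : TensorProduct.assoc R V.carrier C N.carrier
          ((rcoact R C V.carrier).rTensor N.carrier t.1) =
          (lcoact R C N.carrier).lTensor V.carrier t.1 := sub_eq_zero.1 t.2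
      exact (LinearEquiv.eq_symm_apply _).2 h
  have hk : (i ≫ theta F V.carrier (reg R C)) ≫ F.map (map₁ (reg R C) (rcoact R C V.carrier)) =
      (i ≫ theta F V.carrier (reg R C)) ≫
        F.map (map₂ V.carrier (rho (reg R C)) ≫ assocInv V.carrier C (reg R C)) := by
    rw [Category.assoc, ← map₁_theta, ← Category.assoc, hi, Category.assoc, Category.assoc,
      ← map₂_theta_theta, F.map_comp, Category.assoc, ← Category.assoc (theta F _ _), ← map₂_theta,
      ← beta_theta, map₂_comp]
    simp only [Category.assoc]
  -- `F` preserves the equalizer presenting `V`, and `V □_C F(C)` maps to it through `theta`; the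
  -- lift `l` is the inverse of `toCotensor`.
  obtain ⟨l, hl⟩ := Limits.Fork.IsLimit.lift'
    (Limits.isLimitForkMapOfIsLimit F _ (rhoIsLimit V)) _ hk
  refine ⟨l.1 t, Subtype.ext ((bijective_of_isIso (theta F V.carrier (reg R C))).1 ?_)⟩
  refine (congr_hom (beta_theta F V) (l.1 t)).trans (congr_hom hl t)

/-- Under `X ⊗ F(C) ≅ F(X ⊗ C)`, tensoring with `F(C)` is tensoring with the flat `C` followed by
`F`, and both steps keep injections. -/
instance flat_obj [Module.Flat R C] : Module.Flat R (F.obj (reg R C)).carrier := by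
  refine Module.Flat.iff_rTensor_preserves_injective_linearMap.2 fun X Y _ _ _ _ h hh => ?_
  have h1 : Function.Injective (F.map (map₁ (reg R C) h)).1 :=
    map_injective_of_injective F (Module.Flat.rTensor_preserves_injective_linearMap h hh)
  have h2 : Function.Injective (theta F X (reg R C) ≫ F.map (map₁ (reg R C) h)).1 :=
    h1.comp (bijective_of_isIso (theta F X (reg R C))).1
  rw [← map₁_theta] at h2
  exact Function.Injective.of_comp (f := (theta F Y (reg R C)).1) h2

/-- `β` is injective at `X ⊗ V` as well as at `V`, and up to `theta` it is `id_X ⊗ β` there. Hence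
`β`, whose image is the cotensor product, stays injective after tensoring with any `X`. -/
theorem isPure_cotensor : IsPure (Cotensor R C V.carrier (F.obj (reg R C)).carrier) := by
  intro X _ _
  rw [← LinearMap.lTensor_inj_iff_rTensor_inj]
  have h : Function.Injective (theta F X V ≫ beta F (tens X V)).1 :=
    (beta_injective F).comp (bijective_of_isIso (theta F X V)).1
  rw [theta_beta] at h
  have h' : Function.Injective ((beta F V).1.lTensor X) :=
    Function.Injective.of_comp (f := (assocInv X V.carrier (F.obj (reg R C))).1) h
  rw [← subtype_comp_toCotensor, LinearMap.lTensor_comp, LinearMap.coe_comp] at h'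
  exact Function.Injective.of_comp_right h'
    ((LinearEquiv.ofBijective _ (toCotensor_bijective F (V := V))).lTensor X).surjective

end Theta

/-! ### The context of a linear equivalence -/

section EquivalenceContext

variable {R : Type u} [CommRing R] {C : Type u} [AddCommGroup C] [Module R C] [Coalgebra R C]
  {D : Type u} [AddCommGroup D] [Module R D] [Coalgebra R D]
  (F : RightComodCat R C ⥤ RightComodCat R D) [F.Additive] [F.Linear R] [F.IsEquivalence]
  (G : RightComodCat R D ⥤ RightComodCat R C) [G.Additive] [G.Linear R] [G.IsEquivalence]
  (η : 𝟭 _ ≅ F ⋙ G) (ι : 𝟭 _ ≅ G ⋙ F)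

variable {F G} in
/-- The component `W → FG(W)` of a natural isomorphism. -/
def isoApp (W : RightComodCat R D) : W ⟶ F.obj (G.obj W) := ι.hom.app W

variable {F G} in
theorem isoApp_naturality {V W : RightComodCat R D} (f : V ⟶ W) :
    f ≫ isoApp ι W = isoApp ι V ≫ F.map (G.map f) :=
  ι.hom.naturality f

variable {F G} in
instance isoApp_isIso (W : RightComodCat R D) : IsIso (isoApp ι W) :=
  inferInstanceAs (IsIso (ι.hom.app W))

/-- The map `D ≅ FG(D) → G(D) ⊗ F(C)`. -/
noncomputable def unitBeta : reg R D ⟶ tens (G.obj (reg R D)).carrier (F.obj (reg R C)) :=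
  isoApp ι (reg R D) ≫ beta F (G.obj (reg R D))

variable {F G}

/-- The natural isomorphism `W ≅ FG(W)` respects tensoring with `X`: composing the comparison maps
of `F` and `G` gives that of `FG`. -/
theorem map₂_unit_theta {X : Type u} [AddCommGroup X] [Module R X] (W : RightComodCat R D) :
    map₂ X (isoApp ι W) ≫ theta F X (G.obj W) ≫ F.map (theta G X W) = isoApp ι (tens X W) := by
  refine ins_hom_ext fun x => ?_
  rw [← Category.assoc, ins_map₂, Category.assoc, ← Category.assoc (ins _ x), ins_theta,
    ← F.map_comp, ins_theta, isoApp_naturality]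

theorem unitBeta_left : IsLeftColinear R D (unitBeta F G ι).1 := by
  let N := F.obj (reg R C)
  let M := G.obj (reg R D)
  have h1 : isoApp ι (reg R D) ≫ F.map (beta G (reg R D)) =
      rho (reg R D) ≫ map₂ D (isoApp ι (reg R D)) ≫ theta F D M := by
    rw [← cancel_mono (F.map (theta G D (reg R D)))]
    simp only [Category.assoc]
    rw [map₂_unit_theta, ← F.map_comp, isoApp_naturality, beta_theta]
  have h2 : unitBeta F G ι ≫ map₁ N (beta G (reg R D)).1 =
      rho (reg R D) ≫ map₂ D (unitBeta F G ι) ≫ assocInv D M.carrier N := by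
    rw [unitBeta, Category.assoc, ← beta_naturality, ← Category.assoc, h1, map₂_comp]
    simp only [Category.assoc]
    rw [theta_beta]
  refine LinearMap.ext fun d => ?_
  have h3 : (lcoact R D M.carrier).rTensor N.carrier ((unitBeta F G ι).1 d) =
      (TensorProduct.assoc R D M.carrier N.carrier).symm
        ((unitBeta F G ι).1.lTensor D (Coalgebra.comul (R := R) d)) := congr_hom h2 d
  exact (LinearEquiv.eq_symm_apply _).1 h3

/-- The map `v ↦ v₀ ⊗ g(v₁)` is the abstract unit `V → GF(V)` followed by the two Eilenberg–Watts
embeddings. -/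
theorem rho_map₂_unitBeta (V : RightComodCat R C) :
    rho V ≫ map₂ V.carrier (unitBeta G F η) ≫
        assocInv V.carrier (F.obj (reg R C)).carrier (G.obj (reg R D)) =
      isoApp η V ≫ beta G (F.obj V) ≫ map₁ (G.obj (reg R D)) (beta F V).1 := by
  let M := G.obj (reg R D)
  let T := theta F V.carrier (reg R C)
  have h1 : map₂ V.carrier (unitBeta G F η) ≫ assocInv V.carrier (F.obj (reg R C)).carrier M ≫
      map₁ M T.1 = isoApp η (tens V.carrier (reg R C)) ≫
        beta G (F.obj (tens V.carrier (reg R C))) := by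
    refine ins_hom_ext fun v => ?_
    rw [← Category.assoc, ins_map₂, Category.assoc, ← Category.assoc (ins _ v), ins_assocInv,
      ← map₁_comp, unitBeta, Category.assoc,
      show T.1 ∘ₗ TensorProduct.mk R V.carrier (F.obj (reg R C)).carrier v =
        (F.map (ins (reg R C) v)).1 from congrArg Subtype.val (ins_theta F (reg R C) v),
      ← beta_naturality, ← Category.assoc, ← Category.assoc, isoApp_naturality]
  have h2 : map₁ M T.1 ≫ map₁ M (inv T).1 = 𝟙 _ := by
    rw [← map₁_comp, ← map₁_id]
    exact congrArg (map₁ M) (congrArg Subtype.val (IsIso.hom_inv_id T))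
  have h3 : (beta F V).1 = (inv T).1 ∘ₗ (F.map (rho V)).1 := rfl
  rw [h3, map₁_comp, ← Category.assoc (beta G _), ← beta_naturality, Category.assoc,
    ← Category.assoc (isoApp η V), ← isoApp_naturality, Category.assoc, ← Category.assoc (isoApp η _), ← h1]
  simp only [Category.assoc]
  rw [h2, Category.comp_id]

theorem lTensor_unitBeta_rcoact
    (h : isoApp η (G.obj (reg R D)) = G.map (isoApp ι (reg R D)))
    (m : (G.obj (reg R D)).carrier) :
    (unitBeta G F η).1.lTensor _ (rcoact R C _ m) =
      TensorProduct.assoc R _ _ _ ((unitBeta F G ι).1.rTensor _ (lcoact R D _ m)) := by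
  have h1 := rho_map₂_unitBeta η (G.obj (reg R D))
  -- The triangle identity replaces the unit at `G(D)` by `G` of a morphism, which naturality of `β`
  -- can then move past; what remains is `f ⊗ id` after the left coaction of `M`.
  rw [h, ← Category.assoc (G.map _)] at h1
  rw [beta_naturality] at h1
  have h2 := congr_hom h1 m
  let M := (G.obj (reg R D)).carrier
  let N := (F.obj (reg R C)).carrier
  have h3 : (TensorProduct.assoc R M N M).symm
      ((unitBeta G F η).1.lTensor M (rcoact R C M m)) =
      (beta F (G.obj (reg R D))).1.rTensor M ((isoApp ι (reg R D)).1.rTensor M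
        (lcoact R D M m)) := h2
  rw [← LinearMap.rTensor_comp_apply] at h3
  exact (LinearEquiv.symm_apply_eq _).1 h3

variable [Module.Flat R C] [Module.Flat R D]

variable (F G) in
/-- The bicomodule morphism `D → G(D) □_C F(C)`. -/
noncomputable def unitCotensor :
    D →ₗ[R] Cotensor R C (G.obj (reg R D)).carrier (F.obj (reg R C)).carrier :=
  toCotensor F (G.obj (reg R D)) ∘ₗ (isoApp ι (reg R D)).1

theorem unitCotensor_right : IsRightColinear R D (unitCotensor F G ι) :=
  (toCotensor_right F).comp (isoApp ι (reg R D)).2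

theorem unitCotensor_left : IsLeftColinear R D (unitCotensor F G ι) :=
  IsLeftColinear.of_comp (cotensor_subtype_leftColinear (C := C))
    (lTensor_subtype_injective D _) (unitBeta_left ι)

theorem unitCotensor_bijective : Function.Bijective (unitCotensor F G ι) :=
  (toCotensor_bijective F).comp (bijective_of_isIso (isoApp ι (reg R D)))

theorem mapRight_unitCotensor
    (h : isoApp η (G.obj (reg R D)) = G.map (isoApp ι (reg R D)))
    (m : (G.obj (reg R D)).carrier) :
    Cotensor.mapRight (G.obj (reg R D)).carrier (unitCotensor G F η) (unitCotensor_left η)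
        (Cotensor.rightUnit R C _ m) =
      Cotensor.assoc R C D _ _ _ (Cotensor.mapLeft (G.obj (reg R D)).carrier (unitCotensor F G ι)
        (unitCotensor_right ι) (Cotensor.leftUnit R D _ m)) := by
  refine Cotensor.inclRight_injective R C D (G.obj (reg R D)).carrier (F.obj (reg R C)).carrier
    (G.obj (reg R D)).carrier ?_
  rw [Cotensor.inclRight_assoc]
  have h1 := lTensor_unitBeta_rcoact η ι h m
  have h2 : (unitBeta G F η).1 = (Cotensor R D (F.obj (reg R C)).carrier
    (G.obj (reg R D)).carrier).subtype ∘ₗ unitCotensor G F η := rfl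
  have h3 : (unitBeta F G ι).1 = (Cotensor R C (G.obj (reg R D)).carrier
    (F.obj (reg R C)).carrier).subtype ∘ₗ unitCotensor F G ι := rfl
  rw [h2, h3, LinearMap.lTensor_comp, LinearMap.rTensor_comp] at h1
  exact h1

variable (F G) in
/-- The Morita–Takeuchi context given by quasi-inverse linear functors satisfying the triangle
identities. -/
noncomputable def contextOfInverse
    (h : isoApp η (G.obj (reg R D)) = G.map (isoApp ι (reg R D)))
    (h' : isoApp ι (F.obj (reg R C)) = F.map (isoApp η (reg R C))) :
    MoritaTakeuchiContext R D C where
  M := (G.obj (reg R D)).carrier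
  N := (F.obj (reg R C)).carrier
  pureMN := isPure_cotensor F
  pureNM := isPure_cotensor G
  f := unitCotensor F G ι
  f_left := unitCotensor_left ι
  f_right := unitCotensor_right ι
  g := unitCotensor G F η
  g_left := unitCotensor_left η
  g_right := unitCotensor_right η
  diagramM := mapRight_unitCotensor η ι h
  diagramN := mapRight_unitCotensor ι η h'

theorem MoritaTakeuchiEquivalent.exists_isStrict (h : MoritaTakeuchiEquivalent R C D) :
    ∃ K : MoritaTakeuchiContext R D C, K.IsStrict := by
  obtain ⟨e, he, he'⟩ := h
  exact ⟨contextOfInverse e.functor e.inverse e.unitIso e.counitIso.symm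
    (e.unit_app_inverse _) (e.counitInv_app_functor _),
    unitCotensor_bijective e.counitIso.symm, unitCotensor_bijective e.unitIso⟩

end EquivalenceContext

end MoritaTakeuchi

theorem mainTheorem2 {R : Type u} [CommRing R]
    (C : Type u) [AddCommGroup C] [Module R C] [Coalgebra R C] [Module.Flat R C]
    (D : Type u) [AddCommGroup D] [Module R D] [Coalgebra R D] [Module.Flat R D] :
    MoritaTakeuchi.MoritaTakeuchiEquivalent R C D ↔
      ∃ K : MoritaTakeuchi.MoritaTakeuchiContext R D C, K.IsStrict :=
  ⟨fun h => h.exists_isStrict, fun ⟨_, hK⟩ => hK.moritaTakeuchiEquivalent⟩
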